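/- Let $A>0$ and consider the field $q_0(x)=1-\dfrac{iA}{\cosh(Ax)}$, $x\in\mathbb R$; it belongs to the finite-density class, i.e. $q_0-1$ is a Schwartz function. Let $c=ig$ be a coupling that is either focusing ($c\in i\mathbb R^+$, i.e. $g>0$) or defocusing ($c>0$, i.e. $g=-ic$). Let $k$ be real with $k^2-c^2>0$ (every real $k$ in the focusing case), and put $\mu=\mu_c(k)=\sqrt{k^2-c^2}=\sqrt{k^2+g^2}>0$. For $q$ in the finite-density class ($q-1$ Schwartz), put $$W=c\begin{pmatrix}0&q\\ q^*&0\end{pmatrix},\qquad P=\begin{pmatrix}1&\frac{\mu-k}{g}\\-\frac{\mu-k}{g}&1\end{pmatrix},\qquad E(x,k)=P\,e^{-i\mu x\sigma_3}.$$ The Jost solutions $\Psi^\pm(x,k)$ are the solutions of $\Psi_x+ik\sigma_3\Psi=W\Psi$ with $\lim_{x\to\pm\infty}E^{-1}\Psi^\pm=I_2$, and the scattering matrix $S(k)$ is defined by $\Psi^+=\Psi^-S(k)$. When $S(k)$ exists uniquely and has the form $$S=\begin{pmatrix}a^*&b\\ \frac{c^*}{c}b^*&a\end{pmatrix},$$ the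 pair $(a,b)$ is called the scattering data $\mathcal F_c[q]$ of $q$ for the coupling $c$. Then $\mathcal F_c[q_0]$ is defined and, for all $k$ as above, $$a(\mu,c)=\frac{\Gamma\left(\frac12-\frac{i\mu}{A}\right)^2}{\Gamma\left(\frac12-g-\frac{i\mu}{A}\right)\Gamma\left(\frac12+g-\frac{i\mu}{A}\right)},\qquad b(\mu,c)=-\sin(\pi g)\,\frac{1}{\cosh\frac{\pi\mu}{A}} .$$ For $c=i$ (that is, $g=1$) this is the soliton data $$a(\mu,i)=\frac{\mu-\mu_1}{\mu-\mu_1^*},\qquad b(\mu,i)=0,\qquad \mu_1=\frac{iA}{2}.$$ Consequently the quench map $\mathcal Q_{c,i}=\mathcal F_c\circ\mathcal F_i^{-1}$ (a composition of relations: it relates the data, for the couplings $i$ and $c$, of one and the same field of the finite-density class) sends the pair $\left(\frac{\mu-\mu_1}{\mu-\mu_1^*},\,0\right)$ with $\mu=\mu_i(k)$ to $$\left(\frac{\Gamma\left(1-\frac iA(\mu-\mu_1)\right)^2}{\Gamma\left(1-g-\frac iA(\mu-\mu_1)\right)\Gamma\left(1+g-\frac iA(\mu-\mu_1)\right)},\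 \sin(\pi g)\,\frac{i}{\sinh\frac{\pi}{A}(\mu-\mu_1)}\right)$$ with $\mu=\mu_c(k)$. -/

import Mathlib

open Filter Topology
open scoped SchwartzMap

noncomputable section

namespace FiniteDensityNLS

/-- A coupling parameter of `i ∂ₜq + ∂ₓ²q - 2 c² (|q|² - 1) q = 0`: either `c > 0` (defocusing)
or `c = i g` with `g > 0` (focusing). -/
def IsCoupling (c : ℂ) : Prop :=
  ∃ g : ℝ, 0 < g ∧ (c = (g : ℂ) ∨ c = Complex.I * (g : ℂ))

/-- The finite-density class with density `1` and phase `0` at both ends: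
`q - 1` is a Schwartz function. -/
def IsFiniteDensity (q : ℝ → ℂ) : Prop :=
  ∃ f : 𝓢(ℝ, ℂ), ∀ x, q x = 1 + f x

/-- The real spectral parameters `k` with `k² - c² > 0` (here `c²` is real). It is all of `ℝ` for
focusing `c`, and `ℝ` minus the interval `[-c, c]` for defocusing `c`. -/
def spectralSet (c : ℂ) : Set ℝ :=
  {k | 0 < k ^ 2 - (c ^ 2).re}

/-- `μ(k) = √(k² - c²)`; for `c = i g` this is `√(k² + g²)`. -/
def mu (c : ℂ) (k : ℝ) : ℝ :=
  Real.sqrt (k ^ 2 - (c ^ 2).re)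

/-- The Pauli matrix `σ₃`. -/
def sigma3 : Matrix (Fin 2) (Fin 2) ℂ :=
  !![1, 0; 0, -1]

/-- The potential `W(x) = c (0, q(x); q*(x), 0)` of the auxiliary problem. -/
def W (c : ℂ) (q : ℝ → ℂ) (x : ℝ) : Matrix (Fin 2) (Fin 2) ℂ :=
  c • !![0, q x; (starRingEnd ℂ) (q x), 0]

/-- The matrix diagonalising `i k σ₃ - c (0, 1; 1, 0)` to `i μ σ₃`. For `c = i g` its off-diagonal
entries are `(μ - k) / g` and `-(μ - k) / g`. -/
def P (c : ℂ) (k : ℝ) : Matrix (Fin 2) (Fin 2) ℂ :=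
  !![1, Complex.I * ((mu c k : ℂ) - (k : ℂ)) / c;
     -(Complex.I * ((mu c k : ℂ) - (k : ℂ)) / c), 1]

/-- The background solution `E(x, k) = P e^{-i μ x σ₃}`. -/
def E (c : ℂ) (k x : ℝ) : Matrix (Fin 2) (Fin 2) ℂ :=
  P c k * !![Complex.exp (-(Complex.I * (mu c k : ℂ) * (x : ℂ))), 0;
             0, Complex.exp (Complex.I * (mu c k : ℂ) * (x : ℂ))]

/-- `Ψ` solves `Ψₓ + i k σ₃ Ψ = W Ψ` on the whole line, and `E⁻¹ Ψ` tends to the identity along `l`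
(`l = atTop` for `Ψ⁺` and `l = atBot` for `Ψ⁻`). -/
structure IsJost (c : ℂ) (q : ℝ → ℂ) (k : ℝ) (l : Filter ℝ)
    (Ψ : ℝ → Matrix (Fin 2) (Fin 2) ℂ) : Prop where
  ode : ∀ (x : ℝ) (i j : Fin 2), HasDerivAt (fun y => Ψ y i j)
    (((-(Complex.I * (k : ℂ))) • sigma3 * Ψ x + W c q x * Ψ x) i j) x
  normalization : Tendsto (fun x => (E c k x)⁻¹ * Ψ x) l (𝓝 1)

/-- `S` connects the two Jost solutions: `Ψ⁺(x, k) = Ψ⁻(x, k) S`. -/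
def IsScatteringMatrix (c : ℂ) (q : ℝ → ℂ) (k : ℝ) (S : Matrix (Fin 2) (Fin 2) ℂ) : Prop :=
  ∃ Ψp Ψm : ℝ → Matrix (Fin 2) (Fin 2) ℂ,
    IsJost c q k atTop Ψp ∧ IsJost c q k atBot Ψm ∧ ∀ x, Ψp x = Ψm x * S

/-- The direct scattering map with coupling `c` sends `q` to the scattering data `(a, b)`: for each
`k` in the spectral set, `q` has exactly one scattering matrix, and it is
`(a*, b; (c*/c) b*, a)`. -/
def HasScatteringData (c : ℂ) (q : ℝ → ℂ) (a b : ℝ → ℂ) : Prop :=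
  ∀ k ∈ spectralSet c, ∀ S : Matrix (Fin 2) (Fin 2) ℂ,
    IsScatteringMatrix c q k S ↔
      S = !![(starRingEnd ℂ) (a k), b k;
             (starRingEnd ℂ) c / c * (starRingEnd ℂ) (b k), a k]

/-- The quench map `F_{c'} ∘ F_c⁻¹` (composition as relations) sends the data `(a, b)` to
`(a', b')`: some field of the finite-density class has data `(a, b)` for the coupling `c` and
data `(a', b')` for the coupling `c'`. -/
def QuenchMapsTo (c' c : ℂ) (a b a' b' : ℝ → ℂ) : Prop :=
  ∃ q : ℝ → ℂ, IsFiniteDensity q ∧ HasScatteringData c q a b ∧ HasScatteringData c' q a' b'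

/-- The one-soliton profile `1 - i A / cosh (A x)`. -/
def solitonProfile (A : ℝ) (x : ℝ) : ℂ :=
  1 - Complex.I * (A : ℂ) / (Real.cosh (A * x) : ℂ)

end FiniteDensityNLS

end

/-! Since `q₀ - 1` is purely imaginary, the soliton adds to the constant background a real multiple
of `g` times `J = (0, 1; -1, 0)`. The matrix `P` is `1 + αJ`, so it commutes with this term while
diagonalising the background (`auxiliary_mul_P`). What remains is the Zakharov-Shabat system with
potential `g A / cosh (A x)`, vanishing at both ends.

In the variable `z = (1 + tanh (A x)) / 2` this system becomes Gauss's equation: with `γ = 1/2 -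
iμ/A`, the left Jost solution is built from `F = ₂F₁(g, -g; γ; z)` and `F'`. Its limits at `x → +∞`
are boundary values at `z = 1`. The diagonal ones are `F(1)`, given by Gauss's theorem
(`tsum_hypCoeff`). The off-diagonal ones need the leading growth `C (1 - z) ^ (γ - 1)` of `F'`
(`tendsto_derivative_hypergeometric`). It comes from comparing Taylor coefficients with a binomial
series, and the reflection formula turns `C / g` into `-sin (πg) / sin (πγ)`.

Wronskians of the traceless system are constant, so the limit matrix has determinant one and its
adjugate is the only scattering matrix (`isScatteringMatrix_iff`). The prescribed form of `S`
follows by conjugation: `g` is real in the focusing case and imaginary in the defocusing one. The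
quench needs no inverse scattering, because the same field serves both couplings. -/

noncomputable section

namespace FiniteDensityNLS

/-! ### Power series in the unit disc and the hypergeometric equation -/

/-- The coefficients of the Gauss hypergeometric series `₂F₁(g, -g; γ; z)`. -/
def hypCoeff (g γ : ℂ) (n : ℕ) : ℂ :=
  ∏ j ∈ Finset.range n, ((j : ℂ) ^ 2 - g ^ 2) / (((j : ℂ) + 1) * (γ + j))

/-- The derivative coefficients of a power series. -/
def derivCoeff (t : ℕ → ℂ) (n : ℕ) : ℂ := ((n : ℂ) + 1) * t (n + 1)

/-- The sum of the power series with coefficients `t`. -/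
def powerSum (t : ℕ → ℂ) (z : ℂ) : ℂ := ∑' n, t n * z ^ n

theorem summable_mul_pow {t : ℕ → ℂ} {K : ℝ} (ht : ∀ n, ‖t n‖ ≤ K) {z : ℂ} (hz : ‖z‖ < 1) :
    Summable fun n => t n * z ^ n := by
  refine Summable.of_norm_bounded
    ((summable_geometric_of_lt_one (norm_nonneg z) hz).mul_left K) fun n => ?_
  rw [norm_mul, norm_pow]
  exact mul_le_mul_of_nonneg_right (ht n) (by positivity)

theorem summable_natCast_mul_pow_pred {r : ℝ} (h0 : 0 ≤ r) (h1 : r < 1) :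
    Summable fun n : ℕ => (n : ℝ) * r ^ (n - 1) := by
  rw [← summable_nat_add_iff 1]
  have h := summable_pow_mul_geometric_of_norm_lt_one (R := ℝ) 1
    (r := r) (by rwa [Real.norm_of_nonneg h0])
  refine ((h.add (summable_geometric_of_lt_one h0 h1))).congr fun n => ?_
  simp
  ring

theorem hasSum_deriv_shift {t : ℕ → ℂ} {K : ℝ} (ht : ∀ n, ‖t n‖ ≤ K) {z : ℂ} (hz : ‖z‖ < 1) :
    HasSum (fun n : ℕ => t n * ((n : ℂ) * z ^ (n - 1))) (powerSum (derivCoeff t) z) := by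
  have hs : Summable fun n : ℕ => t n * ((n : ℂ) * z ^ (n - 1)) := by
    refine Summable.of_norm_bounded
      ((summable_natCast_mul_pow_pred (norm_nonneg z) hz).mul_left K) fun n => ?_
    rw [norm_mul, norm_mul, norm_pow, Complex.norm_natCast]
    exact mul_le_mul_of_nonneg_right (ht n) (by positivity)
  have h := hs.hasSum
  rw [hs.tsum_eq_zero_add] at h
  convert h using 1
  simp only [powerSum, derivCoeff, Nat.cast_zero, zero_mul, mul_zero, zero_add]
  refine tsum_congr fun n => ?_
  simp
  ring

theorem hasDerivAt_powerSum {t : ℕ → ℂ} {K : ℝ} (ht : ∀ n, ‖t n‖ ≤ K) {z : ℂ} (hz : ‖z‖ < 1) :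
    HasDerivAt (powerSum t) (powerSum (derivCoeff t) z) z := by
  obtain ⟨r, hr, hr1⟩ := exists_between hz
  have hr0 : 0 ≤ r := (norm_nonneg z).trans hr.le
  have hK : 0 ≤ K := (norm_nonneg _).trans (ht 0)
  have key := hasDerivAt_tsum_of_isPreconnected (𝕜 := ℂ) (F := ℂ)
    (u := fun n : ℕ => K * ((n : ℝ) * r ^ (n - 1)))
    (g := fun n y => t n * y ^ n) (g' := fun n y => t n * ((n : ℂ) * y ^ (n - 1)))
    (t := Metric.ball 0 r) (y₀ := z) (y := z)
    ((summable_natCast_mul_pow_pred hr0 hr1).mul_left K) Metric.isOpen_ball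
    (convex_ball (0 : ℂ) r).isPreconnected
    (fun n y _ => (hasDerivAt_pow n y).const_mul (t n))
    (fun n y hy => ?_) (by simpa using hr) (summable_mul_pow ht hz) (by simpa using hr)
  · rw [(hasSum_deriv_shift ht hz).tsum_eq] at key
    exact key
  · rw [norm_mul, norm_mul, norm_pow, Complex.norm_natCast]
    have : ‖y‖ ≤ r := by simpa using (Metric.mem_ball.1 hy).le
    gcongr
    exact ht n

theorem hasSum_index_mul_pow {t : ℕ → ℂ} {K : ℝ} (ht : ∀ n, ‖t n‖ ≤ K) {z : ℂ} (hz : ‖z‖ < 1) :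
    HasSum (fun n : ℕ => (n : ℂ) * t n * z ^ n) (z * powerSum (derivCoeff t) z) := by
  have h := (hasSum_deriv_shift ht hz).mul_left z
  have e : (fun n : ℕ => z * (t n * ((n : ℂ) * z ^ (n - 1)))) =
      fun n : ℕ => (n : ℂ) * t n * z ^ n := by
    ext n
    rcases n with _ | n
    · simp
    · simp only [Nat.add_sub_cancel, pow_succ]
      ring
  rwa [e] at h

theorem hypCoeff_zero (g γ : ℂ) : hypCoeff g γ 0 = 1 := by simp [hypCoeff]

theorem hypCoeff_succ (g γ : ℂ) (n : ℕ) : hypCoeff g γ (n + 1) =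
    hypCoeff g γ n * (((n : ℂ) ^ 2 - g ^ 2) / (((n : ℂ) + 1) * (γ + n))) := by
  rw [hypCoeff, Finset.prod_range_succ, ← hypCoeff]

theorem add_natCast_ne_zero {γ : ℂ} (hγ : 0 < γ.re) (n : ℕ) : γ + n ≠ 0 := by
  intro h
  have := congrArg Complex.re h
  simp at this
  have : (0 : ℝ) ≤ n := n.cast_nonneg
  linarith

theorem hypCoeff_recurrence {g γ : ℂ} (hγ : 0 < γ.re) (n : ℕ) :
    ((n : ℂ) + 1) * (γ + n) * hypCoeff g γ (n + 1) = ((n : ℂ) ^ 2 - g ^ 2) * hypCoeff g γ n := by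
  have h1 := add_natCast_ne_zero hγ n
  have h2 : (n : ℂ) + 1 ≠ 0 := n.cast_add_one_ne_zero
  rw [hypCoeff_succ]
  field_simp

/-- Comparing coefficients of `z ^ n` reduces the equation to the two-term recurrence. The
parameters `g` and `-g` sum to zero, hence the coefficient `γ - z` of the first derivative. -/
theorem hypergeometric_ode {g γ : ℂ} (hγ : 0 < γ.re) {K K' : ℝ} (ht : ∀ n, ‖hypCoeff g γ n‖ ≤ K)
    (ht' : ∀ n, ‖derivCoeff (hypCoeff g γ) n‖ ≤ K') {z : ℂ} (hz : ‖z‖ < 1) :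
    z * (1 - z) * powerSum (derivCoeff (derivCoeff (hypCoeff g γ))) z +
      (γ - z) * powerSum (derivCoeff (hypCoeff g γ)) z + g ^ 2 * powerSum (hypCoeff g γ) z = 0 := by
  set t := hypCoeff g γ
  have h0 : HasSum (fun n => t n * z ^ n) (powerSum t z) := (summable_mul_pow ht hz).hasSum
  have h1 : HasSum (fun n => derivCoeff t n * z ^ n) (powerSum (derivCoeff t) z) :=
    (summable_mul_pow ht' hz).hasSum
  have h2 := hasSum_index_mul_pow ht hz
  have h3 := hasSum_index_mul_pow ht' hz
  have h4 : HasSum (fun n : ℕ => (n : ℂ) * ((n : ℂ) - 1) * t n * z ^ n)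
      (z * (z * powerSum (derivCoeff (derivCoeff t)) z)) := by
    refine (hasSum_nat_add_iff' 1).1 ?_
    have e : (fun n : ℕ => z * ((n : ℂ) * derivCoeff t n * z ^ n)) =
        fun n : ℕ => ((n + 1 : ℕ) : ℂ) * (((n + 1 : ℕ) : ℂ) - 1) * t (n + 1) * z ^ (n + 1) := by
      ext n
      simp only [derivCoeff]
      push_cast
      ring
    have h := h3.mul_left z
    rw [e] at h
    simpa using h
  have h5 := (((h3.sub h4).add (h1.mul_left γ)).sub h2).add (h0.mul_left (g ^ 2))
  have e : (fun n : ℕ => (n : ℂ) * derivCoeff t n * z ^ n - (n : ℂ) * ((n : ℂ) - 1) * t n * z ^ n +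
      γ * (derivCoeff t n * z ^ n) - (n : ℂ) * t n * z ^ n + g ^ 2 * (t n * z ^ n)) =
      fun _ => 0 := by
    ext n
    have h := hypCoeff_recurrence (g := g) hγ n
    simp only [derivCoeff]
    linear_combination z ^ n * h
  rw [e] at h5
  linear_combination h5.unique hasSum_zero

/-! ### Gamma asymptotics of coefficients, and binomial series -/

/-- Inverses are used so that poles of Gamma are allowed, as integer `g` requires. At a pole both
`Complex.Gamma s` and, eventually, `Complex.GammaSeq s n` are `0` by convention, and so are their
inverses, in agreement with the entire function `1/Γ`. -/
theorem tendsto_inv_GammaSeq (s : ℂ) :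
    Tendsto (fun n => (Complex.GammaSeq s n)⁻¹) atTop (𝓝 (Complex.Gamma s)⁻¹) := by
  by_cases h : Complex.Gamma s = 0
  · obtain ⟨m, rfl⟩ := (Complex.Gamma_eq_zero_iff s).1 h
    rw [h, inv_zero]
    refine tendsto_const_nhds.congr' ?_
    filter_upwards [eventually_ge_atTop m] with n hn
    have : ∏ j ∈ Finset.range (n + 1), (-(m : ℂ) + j) = 0 :=
      Finset.prod_eq_zero (Finset.mem_range.2 (Nat.lt_succ_of_le hn)) (by simp)
    simp [Complex.GammaSeq, this]
  · exact (Complex.GammaSeq_tendsto_Gamma s).inv₀ h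

theorem prod_add_natCast_eq (s : ℂ) {n : ℕ} (hn : n ≠ 0) :
    ∏ j ∈ Finset.range (n + 1), (s + j) =
      (n : ℂ) ^ s * n.factorial * (Complex.GammaSeq s n)⁻¹ := by
  have h1 : (n : ℂ) ^ s ≠ 0 := by
    rw [Ne, Complex.cpow_eq_zero_iff]
    simp [hn]
  have h2 : (n.factorial : ℂ) ≠ 0 := by exact_mod_cast n.factorial_ne_zero
  rw [Complex.GammaSeq, inv_div]
  field_simp

/-- The coefficients of the derivative carry products of exactly `n + 1` factors, the length
occurring in `Complex.GammaSeq`. The powers `n ^ g` and `n ^ (-g)` cancel, leaving `n ^ (-γ)`. -/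
theorem derivCoeff_hypCoeff_eq (g γ : ℂ) {n : ℕ} (hn : n ≠ 0) :
    derivCoeff (hypCoeff g γ) n = (n : ℂ) ^ (-γ) *
      ((Complex.GammaSeq g n)⁻¹ * (Complex.GammaSeq (-g) n)⁻¹ * Complex.GammaSeq γ n) := by
  have h0 : (n : ℂ) ≠ 0 := by exact_mod_cast hn
  have h1 : ∏ j ∈ Finset.range (n + 1), ((j : ℂ) + 1) = ((n : ℂ) + 1) * n.factorial := by
    have := Finset.prod_range_add_one_eq_factorial (n + 1)
    rw [Nat.factorial_succ] at this
    exact_mod_cast congrArg (Nat.cast : ℕ → ℂ) this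
  have h2 : ∏ j ∈ Finset.range (n + 1), ((j : ℂ) ^ 2 - g ^ 2) =
      (∏ j ∈ Finset.range (n + 1), (g + (j : ℂ))) *
        ∏ j ∈ Finset.range (n + 1), (-g + (j : ℂ)) := by
    rw [← Finset.prod_mul_distrib]
    exact Finset.prod_congr rfl fun j _ => by ring
  have h3 : (n.factorial : ℂ) ≠ 0 := by exact_mod_cast n.factorial_ne_zero
  have h4 : (n : ℂ) + 1 ≠ 0 := n.cast_add_one_ne_zero
  have h5 : ∀ s : ℂ, (n : ℂ) ^ s ≠ 0 := fun s => by simp [Complex.cpow_eq_zero_iff, hn]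
  rw [derivCoeff, hypCoeff, Finset.prod_div_distrib, Finset.prod_mul_distrib, h1, h2,
    prod_add_natCast_eq g hn, prod_add_natCast_eq (-g) hn, prod_add_natCast_eq γ hn,
    Complex.cpow_neg, Complex.cpow_neg]
  have h6 := h5 g
  have h7 := h5 γ
  rw [div_eq_mul_inv, mul_inv, mul_inv, mul_inv, mul_inv, inv_inv]
  field_simp

/-- The coefficients of the binomial series of `(1 - z) ^ (-s)`. -/
def binomCoeff (s : ℂ) (n : ℕ) : ℂ := ∏ j ∈ Finset.range n, (s + j) / ((j : ℂ) + 1)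

theorem choose_eq_binomCoeff (s : ℂ) (n : ℕ) : Ring.choose (s + n - 1) n = binomCoeff s n := by
  have h := Ring.factorial_nsmul_multichoose_eq_ascPochhammer s n
  have h3 : (n.factorial : ℂ) ≠ 0 := by exact_mod_cast n.factorial_ne_zero
  have h1 : ∏ j ∈ Finset.range n, ((j : ℂ) + 1) = n.factorial := by
    exact_mod_cast congrArg (Nat.cast : ℕ → ℂ) (Finset.prod_range_add_one_eq_factorial n)
  rw [Polynomial.ascPochhammer_smeval_eq_eval, nsmul_eq_mul] at h
  have hp : ∀ m : ℕ, (ascPochhammer ℂ m).eval s = ∏ j ∈ Finset.range m, (s + (j : ℂ)) := by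
    intro m
    induction m with
    | zero => simp
    | succ m ih => rw [ascPochhammer_succ_eval, ih, Finset.prod_range_succ]
  rw [hp] at h
  rw [← Ring.multichoose_eq, binomCoeff, Finset.prod_div_distrib, h1, eq_div_iff h3, ← h, mul_comm]

theorem hasSum_binomCoeff (s : ℂ) {z : ℂ} (hz : ‖z‖ < 1) :
    HasSum (fun n => binomCoeff s n * z ^ n) (1 / (1 - z) ^ s) := by
  have h := (Complex.one_div_one_sub_cpow_hasFPowerSeriesOnBall_zero s).hasSum (y := z)
    (by simpa [enorm_eq_nnnorm, ← NNReal.coe_lt_coe] using hz)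
  simpa [choose_eq_binomCoeff, mul_comm] using h

theorem binomCoeff_eq {s : ℂ} (hs : 0 < s.re) {n : ℕ} (hn : n ≠ 0) :
    binomCoeff s n = (n : ℂ) ^ (s - 1) * ((n : ℂ) / (n + s) * (Complex.GammaSeq s n)⁻¹) := by
  have h0 : (n : ℂ) ≠ 0 := by exact_mod_cast hn
  have h1 : ∏ j ∈ Finset.range n, ((j : ℂ) + 1) = n.factorial := by
    exact_mod_cast congrArg (Nat.cast : ℕ → ℂ) (Finset.prod_range_add_one_eq_factorial n)
  have h2 := prod_add_natCast_eq s hn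
  have h3 : (n.factorial : ℂ) ≠ 0 := by exact_mod_cast n.factorial_ne_zero
  have h4 := add_natCast_ne_zero hs n
  rw [Finset.prod_range_succ] at h2
  rw [binomCoeff, Finset.prod_div_distrib, h1, Complex.cpow_sub _ _ h0, Complex.cpow_one,
    eq_div_of_mul_eq h4 h2, add_comm (n : ℂ) s]
  field_simp

theorem tendsto_natCast_div_add (s : ℂ) :
    Tendsto (fun n : ℕ => (n : ℂ) / (n + s)) atTop (𝓝 1) :=
  tendsto_natCast_div_add_atTop s

/-- A power series whose coefficients are negligible against those of a nonnegative series with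
divergent sum is negligible against that series at `1`. -/
theorem tendsto_powerSum_div {w : ℕ → ℂ} {b : ℕ → ℝ} {H : ℝ → ℝ} (hb : ∀ n, 0 ≤ b n)
    (hsum : ∀ z : ℝ, 0 ≤ z → z < 1 → HasSum (fun n => b n * z ^ n) (H z))
    (hH : Tendsto H (𝓝[<] 1) atTop) (hw : w =o[atTop] b) :
    Tendsto (fun z : ℝ => powerSum w z / (H z : ℂ)) (𝓝[<] 1) (𝓝 0) := by
  rw [Metric.tendsto_nhds]
  intro ε hε
  obtain ⟨N, hN⟩ := eventually_atTop.1 (hw.bound (half_pos hε))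
  -- The head contributes at most the constant `M`, which is below `ε / 2 * H z` once `H z` exceeds
  -- `2 * M / ε`; the tail is at most `ε / 2 * H z` termwise.
  set M := ∑ n ∈ Finset.range N, ‖w n‖
  filter_upwards [hH.eventually_gt_atTop (2 * M / ε), hH.eventually_gt_atTop 0,
    Ioo_mem_nhdsLT (zero_lt_one' ℝ)] with z hz hz0 hz1
  have hM : M < ε / 2 * H z := by
    rw [div_lt_iff₀ hε] at hz
    linarith
  have hs := (hsum z hz1.1.le hz1.2).mul_left (ε / 2)
  have hfin : HasSum (fun n => if n ∈ Finset.range N then ‖w n‖ else 0) M := by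
    have := hasSum_sum_of_ne_finset_zero (s := Finset.range N)
      (L := .unconditional ℕ)
      (f := fun n => if n ∈ Finset.range N then ‖w n‖ else 0) (fun b hb => if_neg hb)
    rwa [Finset.sum_congr rfl fun n hn => if_pos hn] at this
  have hle : ‖powerSum w z‖ ≤ M + ε / 2 * H z := by
    refine tsum_of_norm_bounded (hfin.add hs) fun n => ?_
    have hzn : 0 ≤ z ^ n := pow_nonneg hz1.1.le n
    rw [norm_mul, norm_pow, Complex.norm_real, Real.norm_of_nonneg hz1.1.le]
    split_ifs with h
    · have h1 : z ^ n ≤ 1 := pow_le_one₀ hz1.1.le hz1.2.le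
      have := mul_le_mul_of_nonneg_left h1 (norm_nonneg (w n))
      have := mul_nonneg (hb n) hzn
      nlinarith
    · have h1 := hN n (by simpa using h)
      rw [Real.norm_of_nonneg (hb n)] at h1
      nlinarith [mul_le_mul_of_nonneg_right h1 hzn]
  rw [dist_zero_right, norm_div, Complex.norm_real, Real.norm_of_nonneg hz0.le, div_lt_iff₀ hz0]
  linarith

/-! ### Size of the hypergeometric coefficients -/

theorem tendsto_hypCoeff_GammaSeq (g : ℂ) {γ : ℂ} :
    Tendsto (fun n => (Complex.GammaSeq g n)⁻¹ * (Complex.GammaSeq (-g) n)⁻¹ *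
      Complex.GammaSeq γ n) atTop
      (𝓝 ((Complex.Gamma g)⁻¹ * (Complex.Gamma (-g))⁻¹ * Complex.Gamma γ)) :=
  ((tendsto_inv_GammaSeq g).mul (tendsto_inv_GammaSeq (-g))).mul (Complex.GammaSeq_tendsto_Gamma γ)

theorem isBigO_natCast_cpow (s : ℂ) :
    (fun n : ℕ => (n : ℂ) ^ s) =O[atTop] fun n : ℕ => (n : ℝ) ^ s.re := by
  refine Asymptotics.IsBigO.of_bound 1 ?_
  filter_upwards [eventually_gt_atTop 0] with n hn
  rw [Complex.norm_natCast_cpow_of_pos hn, one_mul]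
  exact le_abs_self _

theorem isBigO_derivCoeff_hypCoeff (g γ : ℂ) :
    derivCoeff (hypCoeff g γ) =O[atTop] fun n : ℕ => (n : ℝ) ^ (-γ.re) := by
  have h := (isBigO_natCast_cpow (-γ)).mul ((tendsto_hypCoeff_GammaSeq g (γ := γ)).isBigO_one ℝ)
  refine (h.congr' ?_ ?_)
  · filter_upwards [eventually_ne_atTop 0] with n hn
    exact (derivCoeff_hypCoeff_eq g γ hn).symm
  · simp

theorem tendsto_derivCoeff_hypCoeff (g : ℂ) {γ : ℂ} (hγ : 0 < γ.re) :
    Tendsto (derivCoeff (hypCoeff g γ)) atTop (𝓝 0) :=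
  (isBigO_derivCoeff_hypCoeff g γ).trans_tendsto
    ((tendsto_rpow_neg_atTop hγ).comp tendsto_natCast_atTop_atTop)

theorem exists_bound_derivCoeff_hypCoeff (g : ℂ) {γ : ℂ} (hγ : 0 < γ.re) :
    ∃ K, ∀ n, ‖derivCoeff (hypCoeff g γ) n‖ ≤ K := by
  obtain ⟨K, hK⟩ := (tendsto_derivCoeff_hypCoeff g hγ).norm.bddAbove_range
  exact ⟨K, fun n => hK ⟨n, rfl⟩⟩

theorem tendsto_natCast_mul_hypCoeff (g : ℂ) {γ : ℂ} (hγ : 0 < γ.re) :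
    Tendsto (fun n : ℕ => (n : ℂ) * hypCoeff g γ n) atTop (𝓝 0) := by
  rw [← tendsto_add_atTop_iff_nat 1]
  simpa [derivCoeff] using! tendsto_derivCoeff_hypCoeff g hγ

/-- The coefficient of index `n + 1` is `O(n ^ (-1 - Re γ))`, so the series still converges
absolutely at `z = 1`. -/
theorem summable_norm_hypCoeff (g : ℂ) {γ : ℂ} (hγ : 0 < γ.re) :
    Summable fun n => ‖hypCoeff g γ n‖ := by
  rw [← summable_nat_add_iff 1]
  have h1 : (fun n : ℕ => (((n : ℝ) + 1)⁻¹)) =O[atTop] fun n : ℕ => (n : ℝ) ^ (-1 : ℝ) := by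
    refine Asymptotics.IsBigO.of_bound 1 ?_
    filter_upwards [eventually_gt_atTop 0] with n hn
    have : (0 : ℝ) < n := by exact_mod_cast hn
    rw [Real.rpow_neg_one, Real.norm_of_nonneg (by positivity), Real.norm_of_nonneg (by positivity),
      one_mul]
    exact inv_anti₀ this (by linarith)
  have h2 := h1.mul (isBigO_derivCoeff_hypCoeff g γ).norm_left
  have h3 : Summable fun n : ℕ => (n : ℝ) ^ (-1 - γ.re) :=
    Real.summable_nat_rpow.2 (by linarith)
  refine summable_of_isBigO_nat h3 (h2.congr' ?_ ?_)
  · refine Eventually.of_forall fun n => ?_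
    have : (0 : ℝ) < (n : ℝ) + 1 := by positivity
    have e : ‖((n : ℂ) + 1)‖ = (n : ℝ) + 1 := by
      rw [← Nat.cast_add_one, Complex.norm_natCast, Nat.cast_add_one]
    simp only [derivCoeff, norm_mul, e]
    field_simp
  · filter_upwards [eventually_gt_atTop 0] with n hn
    have : (0 : ℝ) < n := by exact_mod_cast hn
    rw [← Real.rpow_add this, sub_eq_add_neg]

theorem exists_bound_hypCoeff (g : ℂ) {γ : ℂ} (hγ : 0 < γ.re) :
    ∃ K, ∀ n, ‖hypCoeff g γ n‖ ≤ K :=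
  ⟨∑' n, ‖hypCoeff g γ n‖, fun n => (summable_norm_hypCoeff g hγ).le_tsum n fun _ _ => norm_nonneg _⟩

/-! ### Gauss summation -/

theorem hypCoeff_add_one_mul (g : ℂ) {γ : ℂ} (hγ : 0 < γ.re) (n : ℕ) :
    hypCoeff g (γ + 1) n * (γ + n) = γ * hypCoeff g γ n := by
  induction n with
  | zero => simp [hypCoeff_zero]
  | succ n ih =>
    have h1 := add_natCast_ne_zero hγ n
    have h2 := add_natCast_ne_zero hγ (n + 1)
    have h3 : (n : ℂ) + 1 ≠ 0 := n.cast_add_one_ne_zero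
    push_cast at h2 ⊢
    have h4 : γ + 1 + (n : ℂ) ≠ 0 := by rwa [add_right_comm, add_assoc]
    rw [hypCoeff_succ, hypCoeff_succ]
    field_simp
    linear_combination (γ + n + 1) * ((n : ℂ) ^ 2 - g ^ 2) * ih

/-- Termwise, the difference of the two sides is the increment of `-γ n tₙ`, where `tₙ = hypCoeff g
γ n`. The sum telescopes, and `n tₙ → 0`. -/
theorem hypergeometric_contiguous (g : ℂ) {γ : ℂ} (hγ : 0 < γ.re) :
    γ ^ 2 * ∑' n, hypCoeff g γ n = (γ ^ 2 - g ^ 2) * ∑' n, hypCoeff g (γ + 1) n := by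
  have hγ1 : 0 < (γ + 1).re := by simp; linarith
  have h1 := (summable_norm_hypCoeff g hγ).of_norm.hasSum.mul_left (γ ^ 2)
  have h2 := (summable_norm_hypCoeff g hγ1).of_norm.hasSum.mul_left (γ ^ 2 - g ^ 2)
  have h3 := (h1.sub h2).tendsto_sum_nat
  have h4 : ∀ n : ℕ, γ ^ 2 * hypCoeff g γ n - (γ ^ 2 - g ^ 2) * hypCoeff g (γ + 1) n =
      -γ * (((n + 1 : ℕ) : ℂ) * hypCoeff g γ (n + 1)) - -γ * ((n : ℂ) * hypCoeff g γ n) := by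
    intro n
    have h5 := add_natCast_ne_zero hγ n
    refine mul_left_cancel₀ h5 ?_
    push_cast
    linear_combination -(γ ^ 2 - g ^ 2) * hypCoeff_add_one_mul g hγ n +
      γ * hypCoeff_recurrence (g := g) hγ n
  simp_rw [h4, Finset.sum_range_sub (fun n : ℕ => -γ * ((n : ℂ) * hypCoeff g γ n))] at h3
  have h6 := ((tendsto_natCast_mul_hypCoeff g hγ).const_mul (-γ)).sub_const
    (-γ * (((0 : ℕ) : ℂ) * hypCoeff g γ 0))
  have h7 := tendsto_nhds_unique h3 h6
  simp at h7
  linear_combination h7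

theorem norm_add_natCast_le {γ : ℂ} (hγ : 0 < γ.re) (N j : ℕ) : ‖γ + j‖ ≤ ‖γ + N + j‖ := by
  rw [← sq_le_sq₀ (norm_nonneg _) (norm_nonneg _), Complex.sq_norm, Complex.sq_norm,
    Complex.normSq_apply, Complex.normSq_apply]
  simp only [Complex.add_re, Complex.natCast_re, Complex.add_im, Complex.natCast_im, add_zero]
  have : (0 : ℝ) ≤ N := N.cast_nonneg
  have : (0 : ℝ) ≤ j := j.cast_nonneg
  nlinarith

theorem norm_hypCoeff_add_le (g : ℂ) {γ : ℂ} (hγ : 0 < γ.re) (N n : ℕ) :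
    ‖hypCoeff g (γ + N) n‖ ≤ ‖hypCoeff g γ n‖ := by
  rw [hypCoeff, hypCoeff, norm_prod, norm_prod]
  refine Finset.prod_le_prod (fun _ _ => norm_nonneg _) fun j _ => ?_
  rw [norm_div, norm_div, norm_mul, norm_mul]
  have h1 : 0 < ‖γ + j‖ := norm_pos_iff.2 (add_natCast_ne_zero hγ j)
  have h2 : 0 < ‖(j : ℂ) + 1‖ := norm_pos_iff.2 j.cast_add_one_ne_zero
  have := norm_add_natCast_le hγ N j
  gcongr

/-- Every factor of a coefficient tends to `0` as the denominator parameter grows, so only the empty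
product at `n = 0` survives. The coefficients at `N = 0` dominate. -/
theorem tendsto_tsum_hypCoeff_add (g : ℂ) {γ : ℂ} (hγ : 0 < γ.re) :
    Tendsto (fun N : ℕ => ∑' n, hypCoeff g (γ + N) n) atTop (𝓝 1) := by
  have hcob : Tendsto (fun N : ℕ => (N : ℂ)) atTop (Bornology.cobounded ℂ) := by
    rw [← tendsto_norm_atTop_iff_cobounded]
    simpa using tendsto_natCast_atTop_atTop (R := ℝ)
  have h : ∀ n : ℕ, Tendsto (fun N : ℕ => hypCoeff g (γ + N) n) atTop (𝓝 (0 ^ n)) := by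
    intro n
    have h1 : ∀ j ∈ Finset.range n, Tendsto (fun N : ℕ => ((j : ℂ) ^ 2 - g ^ 2) /
        (((j : ℂ) + 1) * (γ + N + j))) atTop (𝓝 0) := by
      intro j _
      suffices h : Tendsto (fun N : ℕ => ((j : ℂ) + 1) * (γ + N + j)) atTop
          (Bornology.cobounded ℂ) by
        simpa [div_eq_mul_inv] using (tendsto_inv₀_cobounded.comp h).const_mul ((j : ℂ) ^ 2 - g ^ 2)
      refine (tendsto_mul_left_cobounded j.cast_add_one_ne_zero).comp ?_
      have := (tendsto_add_const_cobounded (γ + j)).comp hcob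
      refine this.congr fun N => ?_
      simp
      ring
    simpa [hypCoeff] using tendsto_finsetProd (Finset.range n) h1
  have := tendsto_tsum_of_dominated_convergence (summable_norm_hypCoeff g hγ) h
    (Eventually.of_forall fun N n => norm_hypCoeff_add_le g hγ N n)
  rwa [tsum_geometric_of_norm_lt_one (by simp), sub_zero, inv_one] at this

/-- Gauss's summation theorem for `₂F₁(g, -g; γ; 1)`. -/
theorem tsum_hypCoeff (g : ℂ) {γ : ℂ} (hγ : 0 < γ.re) :
    ∑' n, hypCoeff g γ n =
      Complex.Gamma γ ^ 2 / (Complex.Gamma (γ - g) * Complex.Gamma (γ + g)) := by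
  -- The contiguous relation iterated `N` times. Taken at `N = n + 1`, its three products become
  -- `Complex.GammaSeq` at `γ`, `γ - g` and `γ + g`, and their powers of `n` and factorials cancel.
  have hstep : ∀ N : ℕ, (∏ j ∈ Finset.range N, (γ + (j : ℂ))) ^ 2 * ∑' n, hypCoeff g γ n =
      (∏ j ∈ Finset.range N, (γ - g + (j : ℂ))) * (∏ j ∈ Finset.range N, (γ + g + (j : ℂ))) *
        ∑' n, hypCoeff g (γ + N) n := by
    intro N
    induction N with
    | zero => simp
    | succ N ih =>
      have hN : 0 < (γ + N).re := by simp; positivity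
      have h := hypergeometric_contiguous g hN
      rw [Finset.prod_range_succ, Finset.prod_range_succ, Finset.prod_range_succ, Nat.cast_add_one,
        ← add_assoc]
      linear_combination (γ + N) ^ 2 * ih + (∏ j ∈ Finset.range N, (γ - g + (j : ℂ))) *
        (∏ j ∈ Finset.range N, (γ + g + (j : ℂ))) * h
  have hlim := (((Complex.GammaSeq_tendsto_Gamma γ).pow 2).mul
    ((tendsto_inv_GammaSeq (γ - g)).mul (tendsto_inv_GammaSeq (γ + g)))).mul
      ((tendsto_tsum_hypCoeff_add g hγ).comp (tendsto_add_atTop_nat 1))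
  rw [mul_one, ← mul_inv, ← div_eq_mul_inv] at hlim
  refine tendsto_nhds_unique (tendsto_const_nhds.congr' ?_) hlim
  filter_upwards [eventually_ne_atTop 0] with n hn
  have h := hstep (n + 1)
  have h0 : (n : ℂ) ≠ 0 := by exact_mod_cast hn
  have hg : Complex.GammaSeq γ n ≠ 0 := by
    have h1 : ∏ j ∈ Finset.range (n + 1), (γ + (j : ℂ)) ≠ 0 :=
      Finset.prod_ne_zero_iff.2 fun j _ => add_natCast_ne_zero hγ j
    rw [prod_add_natCast_eq γ hn] at h1
    exact fun h => h1 (by simp [h])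
  have h3 : (n.factorial : ℂ) ≠ 0 := by exact_mod_cast n.factorial_ne_zero
  have h5 : ∀ s : ℂ, (n : ℂ) ^ s ≠ 0 := fun s => by simp [Complex.cpow_eq_zero_iff, hn]
  rw [prod_add_natCast_eq _ hn, prod_add_natCast_eq _ hn, prod_add_natCast_eq _ hn,
    Complex.cpow_sub _ _ h0, Complex.cpow_add _ _ h0] at h
  have h6 := h5 g
  have h7 := h5 γ
  have h8 : ((n : ℂ) ^ γ * n.factorial) ^ 2 ≠ 0 := by positivity
  simp only [Function.comp]
  refine mul_left_cancel₀ h8 (mul_left_cancel₀ (inv_ne_zero (pow_ne_zero 2 hg)) ?_)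
  field_simp at h ⊢
  linear_combination h

/-! ### Growth of the derivative at `z = 1` -/

theorem tendsto_binomCoeff_factor (s : ℂ) :
    Tendsto (fun n : ℕ => (n : ℂ) / (n + s) * (Complex.GammaSeq s n)⁻¹) atTop
      (𝓝 (Complex.Gamma s)⁻¹) := by
  simpa using (tendsto_natCast_div_add s).mul (tendsto_inv_GammaSeq s)

theorem isBigO_binomCoeff_half :
    (fun n : ℕ => (n : ℝ) ^ (-(1 / 2) : ℝ)) =O[atTop] binomCoeff (1 / 2) := by
  have hG : Complex.Gamma (1 / 2) ≠ 0 := Complex.Gamma_ne_zero_of_re_pos (by norm_num)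
  have h1 := tendsto_binomCoeff_factor (1 / 2)
  have h2 := ((h1.inv₀ (inv_ne_zero hG)).isBigO_one ℂ)
  have h3 := (Asymptotics.isBigO_refl (binomCoeff (1 / 2)) atTop).mul h2
  simp only [mul_one] at h3
  refine Asymptotics.IsBigO.trans (Asymptotics.IsBigO.of_bound 1 ?_) h3
  filter_upwards [eventually_gt_atTop 0, h1.eventually_ne (inv_ne_zero hG)] with n hn hne
  have hn' : (0 : ℝ) ≤ n := n.cast_nonneg
  rw [binomCoeff_eq (by norm_num) hn.ne', mul_assoc, mul_inv_cancel₀ hne, mul_one, one_mul,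
    Complex.norm_natCast_cpow_of_pos hn, Real.norm_of_nonneg (by positivity)]
  norm_num

/-- The value at `z = 1` of `(1 - z) ^ (1 - γ)` times the derivative of `₂F₁(g, -g; γ; z)`. -/
def connectionConst (g γ : ℂ) : ℂ :=
  (Complex.Gamma g)⁻¹ * (Complex.Gamma (-g))⁻¹ * Complex.Gamma γ * Complex.Gamma (1 - γ)

/-- Both sequences are `n ^ (-γ)` times a convergent factor, and `connectionConst` is the ratio of
the two limits. Since `Re γ = 1/2`, the error is `o(n ^ (-1/2))`, measured against the series of `(1
- z) ^ (-1/2)`. -/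
theorem derivCoeff_sub_isLittleO (g : ℂ) {γ : ℂ} (hγ : γ.re = 1 / 2) :
    (fun n => derivCoeff (hypCoeff g γ) n - connectionConst g γ * binomCoeff (1 - γ) n)
      =o[atTop] binomCoeff (1 / 2) := by
  have hre : 0 < (1 - γ).re := by simp [hγ]; norm_num
  have hG : Complex.Gamma (1 - γ) ≠ 0 := Complex.Gamma_ne_zero_of_re_pos hre
  have h1 := (tendsto_hypCoeff_GammaSeq g (γ := γ)).sub
    ((tendsto_binomCoeff_factor (1 - γ)).const_mul (connectionConst g γ))
  rw [connectionConst, mul_inv_cancel_right₀ hG, sub_self, ← connectionConst] at h1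
  have h2 := (isBigO_natCast_cpow (-γ)).mul_isLittleO ((Asymptotics.isLittleO_one_iff ℝ).2 h1)
  simp only [mul_one, Complex.neg_re, hγ] at h2
  refine Asymptotics.IsLittleO.trans_isBigO (h2.congr' ?_ EventuallyEq.rfl) isBigO_binomCoeff_half
  filter_upwards [eventually_ne_atTop 0] with n hn
  rw [derivCoeff_hypCoeff_eq g γ hn, binomCoeff_eq hre hn, show 1 - γ - 1 = -γ by ring]
  ring

/-- The coefficients of the binomial series of `(1 - z) ^ (-1/2)`. -/
def halfBinom (n : ℕ) : ℝ := ∏ j ∈ Finset.range n, (1 / 2 + (j : ℝ)) / ((j : ℝ) + 1)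

theorem ofReal_halfBinom (n : ℕ) : (halfBinom n : ℂ) = binomCoeff (1 / 2) n := by
  simp [halfBinom, binomCoeff]

theorem hasSum_halfBinom {z : ℝ} (h0 : 0 ≤ z) (h1 : z < 1) :
    HasSum (fun n => halfBinom n * z ^ n) (1 / (1 - z) ^ (1 / 2 : ℝ)) := by
  have h := hasSum_binomCoeff (1 / 2) (z := z) (by rwa [Complex.norm_real, Real.norm_of_nonneg h0])
  rw [← Complex.hasSum_ofReal]
  convert h using 1
  · ext n
    rw [← ofReal_halfBinom]
    push_cast
    rfl
  · have : 0 ≤ 1 - z := by linarith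
    rw [Complex.ofReal_div, Complex.ofReal_cpow this]
    push_cast
    rfl

/-- An Abelian argument: after subtracting `C (1 - z) ^ (γ - 1)`, the remainder is `o((1 - z) ^
(-1/2))`, and `(1 - z) ^ (1 - γ)` has modulus `(1 - z) ^ (1/2)`. The factor `z ^ γ` tends to `1`; it
is kept to match `cexp_div_cosh_eq`. -/
theorem tendsto_derivative_hypergeometric (g : ℂ) {γ : ℂ} (hγ : γ.re = 1 / 2) :
    Tendsto (fun z : ℝ => (z : ℂ) ^ γ * (1 - z : ℂ) ^ (1 - γ) *
      powerSum (derivCoeff (hypCoeff g γ)) z) (𝓝[<] 1) (𝓝 (connectionConst g γ)) := by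
  have hre : 0 < γ.re := by rw [hγ]; norm_num
  set C := connectionConst g γ
  set w := fun n => derivCoeff (hypCoeff g γ) n - C * binomCoeff (1 - γ) n with hw
  set H : ℝ → ℝ := fun z => 1 / (1 - z) ^ (1 / 2 : ℝ) with hH
  have hlim : Tendsto H (𝓝[<] 1) atTop := by
    have h1 : Tendsto (fun z : ℝ => (1 - z) ^ (1 / 2 : ℝ)) (𝓝[<] 1) (𝓝[>] 0) := by
      refine tendsto_nhdsWithin_iff.2 ⟨?_, ?_⟩
      · have : Continuous fun z : ℝ => (1 - z) ^ (1 / 2 : ℝ) :=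
          (continuous_const.sub continuous_id).rpow_const fun _ => Or.inr (by norm_num)
        simpa using (this.tendsto 1).mono_left nhdsWithin_le_nhds
      · filter_upwards [self_mem_nhdsWithin] with z hz
        have : (0 : ℝ) < 1 - z := by simpa using hz
        exact Real.rpow_pos_of_pos this _
    simpa [hH, Function.comp_def] using tendsto_inv_nhdsGT_zero.comp h1
  have hwb : w =o[atTop] halfBinom := by
    refine (derivCoeff_sub_isLittleO g hγ).trans_isBigO (Asymptotics.IsBigO.of_bound 1 ?_)
    refine Eventually.of_forall fun n => ?_
    rw [← ofReal_halfBinom, Complex.norm_real, one_mul]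
  have hab := tendsto_powerSum_div (w := w) (H := H)
    (fun n => Finset.prod_nonneg fun j _ => by positivity) (fun z h0 h1 => hasSum_halfBinom h0 h1)
    hlim hwb
  have hz : Tendsto (fun z : ℝ => (z : ℂ) ^ γ) (𝓝[<] 1) (𝓝 1) := by
    have : ContinuousAt (fun z : ℝ => (z : ℂ) ^ γ) 1 :=
      (Complex.continuous_ofReal.continuousAt).cpow continuousAt_const (by simp)
    simpa [ContinuousAt] using this.tendsto.mono_left nhdsWithin_le_nhds
  have hr : Tendsto (fun z : ℝ => (1 - z : ℂ) ^ (1 - γ) * powerSum w z) (𝓝[<] 1) (𝓝 0) := by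
    refine squeeze_zero_norm' ?_ (tendsto_zero_iff_norm_tendsto_zero.1 hab)
    filter_upwards [self_mem_nhdsWithin] with z hz
    have h1 : (0 : ℝ) < 1 - z := by simpa using hz
    rw [norm_mul, norm_div, ← Complex.ofReal_one, ← Complex.ofReal_sub,
      Complex.norm_cpow_eq_rpow_re_of_pos h1, Complex.norm_real, Real.norm_of_nonneg
      (by positivity)]
    simp only [hH, Complex.sub_re, Complex.ofReal_re, hγ]
    norm_num
    rw [mul_comm]
  have := hz.mul (hr.const_add C)
  rw [one_mul, add_zero] at this
  refine this.congr' ?_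
  filter_upwards [Ioo_mem_nhdsLT (zero_lt_one' ℝ)] with z hz
  obtain ⟨K, hK⟩ := exists_bound_derivCoeff_hypCoeff g hre
  have hz1 : ‖(z : ℂ)‖ < 1 := by rw [Complex.norm_real, Real.norm_of_nonneg hz.1.le]; exact hz.2
  have h1 := (summable_mul_pow hK hz1).hasSum
  have h2 := (hasSum_binomCoeff (1 - γ) hz1).mul_left C
  have h3 : powerSum w z = powerSum (derivCoeff (hypCoeff g γ)) z -
      C * (1 / (1 - (z : ℂ)) ^ (1 - γ)) := by
    rw [powerSum, powerSum, ← (h1.sub h2).tsum_eq]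
    exact tsum_congr fun n => by simp only [hw]; ring
  have h4 : (1 - z : ℂ) ^ (1 - γ) ≠ 0 := by
    rw [Ne, Complex.cpow_eq_zero_iff]
    intro h
    have := hz.2.ne'
    exact this (by exact_mod_cast sub_eq_zero.1 h.1)
  rw [h3]
  field_simp
  ring

/-! ### The left Jost solution and its limits -/

/-- The first component of the left Jost solution of `u' = (g A / cosh (A x)) v`,
`v' = (1 - 2 γ) A v - (g A / cosh (A x)) u`. -/
def jostU (g γ : ℂ) (A x : ℝ) : ℂ := powerSum (hypCoeff g γ) (Real.sigmoid (2 * (A * x)))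

/-- The second component of the left Jost solution of `u' = (g A / cosh (A x)) v`,
`v' = (1 - 2 γ) A v - (g A / cosh (A x)) u`. -/
def jostV (g γ : ℂ) (A x : ℝ) : ℂ :=
  powerSum (derivCoeff (hypCoeff g γ)) (Real.sigmoid (2 * (A * x))) / (2 * g * Real.cosh (A * x))

theorem sigmoid_two_mul (y : ℝ) : Real.sigmoid (2 * y) = Real.exp y / (2 * Real.cosh y) := by
  rw [Real.sigmoid_def, Real.cosh_eq, show -(2 * y) = -y + -y by ring, Real.exp_add, Real.exp_neg]
  have := Real.exp_pos y
  field_simp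

theorem one_sub_sigmoid_two_mul (y : ℝ) :
    1 - Real.sigmoid (2 * y) = Real.exp (-y) / (2 * Real.cosh y) := by
  rw [← Real.sigmoid_neg, show -(2 * y) = 2 * (-y) by ring, sigmoid_two_mul, Real.cosh_neg]

theorem norm_sigmoid_lt_one (y : ℝ) : ‖(Real.sigmoid y : ℂ)‖ < 1 := by
  rw [Complex.norm_real, Real.norm_of_nonneg (Real.sigmoid_nonneg y)]
  exact Real.sigmoid_lt_one y

theorem hasDerivAt_sigmoid_two_mul (A x : ℝ) :
    HasDerivAt (fun y : ℝ => (Real.sigmoid (2 * (A * y)) : ℂ))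
      ((A : ℂ) / (2 * (Real.cosh (A * x) : ℂ) ^ 2)) x := by
  have h1 : HasDerivAt (fun y : ℝ => 2 * (A * y)) (2 * A) x := by
    simpa using ((hasDerivAt_id x).const_mul A).const_mul 2
  have h2 := ((Real.hasDerivAt_sigmoid (2 * (A * x))).comp x h1).ofReal_comp
  refine h2.congr_deriv ?_
  rw [Complex.ofReal_mul, Complex.ofReal_mul, one_sub_sigmoid_two_mul, sigmoid_two_mul]
  have hc : (Real.cosh (A * x) : ℂ) ≠ 0 := by exact_mod_cast (Real.cosh_pos _).ne'
  have he : (Real.exp (A * x) : ℂ) * Real.exp (-(A * x)) = 1 := by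
    rw [← Complex.ofReal_mul, ← Real.exp_add]
    simp
  simp only [Complex.ofReal_mul, Complex.ofReal_div, Complex.ofReal_ofNat]
  field_simp
  linear_combination (A : ℂ) * he

/-- Here `dz/dx = A / (2 cosh² (A x))`; `jostV` is what this first equation forces as second
component. -/
theorem hasDerivAt_jostU {g γ : ℂ} (hg : g ≠ 0) (hγ : 0 < γ.re) (A x : ℝ) :
    HasDerivAt (jostU g γ A) (g * A / Real.cosh (A * x) * jostV g γ A x) x := by
  obtain ⟨K, hK⟩ := exists_bound_hypCoeff g hγ
  have h := (hasDerivAt_powerSum hK (norm_sigmoid_lt_one (2 * (A * x)))).comp x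
    (hasDerivAt_sigmoid_two_mul A x)
  have hc : (Real.cosh (A * x) : ℂ) ≠ 0 := by exact_mod_cast (Real.cosh_pos _).ne'
  refine h.congr_deriv ?_
  simp only [jostV]
  field_simp

theorem hasDerivAt_jostV {g γ : ℂ} (hg : g ≠ 0) (hγ : 0 < γ.re) (A x : ℝ) :
    HasDerivAt (jostV g γ A)
      ((1 - 2 * γ) * A * jostV g γ A x - g * A / Real.cosh (A * x) * jostU g γ A x) x := by
  obtain ⟨K, hK⟩ := exists_bound_hypCoeff g hγ
  obtain ⟨K', hK'⟩ := exists_bound_derivCoeff_hypCoeff g hγ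
  have h := (hasDerivAt_powerSum hK' (norm_sigmoid_lt_one (2 * (A * x)))).comp x
    (hasDerivAt_sigmoid_two_mul A x)
  have h1 : HasDerivAt (fun y : ℝ => A * y) A x := by simpa using (hasDerivAt_id x).const_mul A
  have h2 := (((Real.hasDerivAt_cosh (A * x)).comp x h1).ofReal_comp).const_mul (2 * g)
  have hc : (Real.cosh (A * x) : ℂ) ≠ 0 := by exact_mod_cast (Real.cosh_pos _).ne'
  have h3 := h.div h2 (by simpa using ⟨hg, by simpa using hc⟩)
  refine h3.congr_deriv ?_
  have hode := hypergeometric_ode (g := g) hγ hK hK' (norm_sigmoid_lt_one (2 * (A * x)))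
  have e1 : (1 : ℂ) - (Real.sigmoid (2 * (A * x)) : ℂ) =
      (Real.exp (-(A * x)) : ℂ) / (2 * (Real.cosh (A * x) : ℂ)) := by
    exact_mod_cast congrArg Complex.ofReal (one_sub_sigmoid_two_mul (A * x))
  have e2 : (Real.sigmoid (2 * (A * x)) : ℂ) =
      (Real.exp (A * x) : ℂ) / (2 * (Real.cosh (A * x) : ℂ)) := by
    exact_mod_cast congrArg Complex.ofReal (sigmoid_two_mul (A * x))
  have he : (Real.exp (A * x) : ℂ) * Real.exp (-(A * x)) = 1 := by
    rw [← Complex.ofReal_mul, ← Real.exp_add]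
    simp
  have hs : (Real.exp (A * x) : ℂ) = Real.cosh (A * x) + Real.sinh (A * x) := by
    exact_mod_cast (Real.cosh_add_sinh (A * x)).symm
  simp only [jostU, jostV, Function.comp_apply, Complex.ofReal_mul]
  -- Only algebra remains: the hypergeometric equation with `z` and `1 - z` written through `exp (±
  -- A x)`, the product of the two exponentials, and `exp = cosh + sinh`.
  generalize powerSum (derivCoeff (derivCoeff (hypCoeff g γ))) _ = F2 at *
  generalize powerSum (derivCoeff (hypCoeff g γ)) _ = F1 at *
  generalize powerSum (hypCoeff g γ) _ = F0 at *
  rw [e1, e2] at hode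
  generalize (Real.cosh (A * x) : ℂ) = ch at *
  generalize (Real.sinh (A * x) : ℂ) = sh at *
  generalize (Real.exp (A * x) : ℂ) = p at *
  generalize (Real.exp (-(A * x)) : ℂ) = q at *
  field_simp at hode ⊢
  linear_combination (A : ℂ) * hode - A * F2 * he + 2 * ch * A * F1 * hs

/-- `z` and `1 - z` are `exp (± y) / (2 cosh y)`. Writing these positive numbers as real
exponentials removes any question of branches. -/
theorem cexp_div_cosh_eq (γ : ℂ) (y : ℝ) :
    Complex.exp ((2 * γ - 1) * y) / (2 * Real.cosh y) =
      (Real.sigmoid (2 * y) : ℂ) ^ γ * (1 - Real.sigmoid (2 * y) : ℂ) ^ (1 - γ) := by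
  have hc : 0 < 2 * Real.cosh y := by have := Real.cosh_pos y; positivity
  have e1 : Real.sigmoid (2 * y) = Real.exp (y - Real.log (2 * Real.cosh y)) := by
    rw [sigmoid_two_mul, Real.exp_sub, Real.exp_log hc]
  have e2 : 1 - Real.sigmoid (2 * y) = Real.exp (-y - Real.log (2 * Real.cosh y)) := by
    rw [one_sub_sigmoid_two_mul, Real.exp_sub, Real.exp_log hc]
  have e3 : ∀ (r : ℝ) (s : ℂ), (Real.exp r : ℂ) ^ s = Complex.exp (r * s) := by
    intro r s
    rw [Complex.cpow_def_of_ne_zero (by exact_mod_cast (Real.exp_pos r).ne'),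
      ← Complex.ofReal_log (Real.exp_pos r).le, Real.log_exp]
  have e4 : (2 * Real.cosh y : ℂ) = Complex.exp (Real.log (2 * Real.cosh y)) := by
    rw [← Complex.ofReal_exp, Real.exp_log hc]
    push_cast
    rfl
  rw [← Complex.ofReal_one, ← Complex.ofReal_sub, e2, e1, e3, e3, e4, ← Complex.exp_sub,
    ← Complex.exp_add]
  congr 1
  push_cast
  ring

theorem tendsto_two_mul_atTop {A : ℝ} (hA : 0 < A) :
    Tendsto (fun x : ℝ => 2 * (A * x)) atTop atTop :=
  (tendsto_id.const_mul_atTop hA).const_mul_atTop two_pos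

theorem tendsto_two_mul_atBot {A : ℝ} (hA : 0 < A) :
    Tendsto (fun x : ℝ => 2 * (A * x)) atBot atBot :=
  (tendsto_id.const_mul_atBot hA).const_mul_atBot two_pos

theorem powerSum_zero (t : ℕ → ℂ) : powerSum t 0 = t 0 := by
  rw [powerSum, tsum_eq_single 0]
  · simp
  · intro n hn
    simp [hn]

theorem tendsto_powerSum_sigmoid_atBot {t : ℕ → ℂ} {K : ℝ} (ht : ∀ n, ‖t n‖ ≤ K) {A : ℝ}
    (hA : 0 < A) :
    Tendsto (fun x : ℝ => powerSum t (Real.sigmoid (2 * (A * x)))) atBot (𝓝 (t 0)) := by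
  have h1 : ContinuousAt (powerSum t) 0 := (hasDerivAt_powerSum ht (by simp)).continuousAt
  have h2 := (Complex.continuous_ofReal.tendsto 0).comp
    (Real.tendsto_sigmoid_atBot.comp (tendsto_two_mul_atBot hA))
  have h3 := h1.tendsto.comp (Complex.ofReal_zero ▸ h2)
  rwa [powerSum_zero] at h3

theorem tendsto_jostU_atBot (g : ℂ) {γ : ℂ} (hγ : 0 < γ.re) {A : ℝ} (hA : 0 < A) :
    Tendsto (jostU g γ A) atBot (𝓝 1) := by
  obtain ⟨K, hK⟩ := exists_bound_hypCoeff g hγ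
  simpa [hypCoeff_zero] using! tendsto_powerSum_sigmoid_atBot hK hA

/-- Absolute summability at `z = 1` permits dominated convergence, and Gauss's theorem evaluates the
limit. -/
theorem tendsto_jostU_atTop (g : ℂ) {γ : ℂ} (hγ : 0 < γ.re) {A : ℝ} (hA : 0 < A) :
    Tendsto (jostU g γ A) atTop
      (𝓝 (Complex.Gamma γ ^ 2 / (Complex.Gamma (γ - g) * Complex.Gamma (γ + g)))) := by
  rw [← tsum_hypCoeff g hγ]
  refine tendsto_tsum_of_dominated_convergence (summable_norm_hypCoeff g hγ) (fun n => ?_)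
    (Eventually.of_forall fun x n => ?_)
  · have h2 := (Complex.continuous_ofReal.tendsto 1).comp
      (Real.tendsto_sigmoid_atTop.comp (tendsto_two_mul_atTop hA))
    simpa using (h2.pow n).const_mul (hypCoeff g γ n)
  · rw [norm_mul, norm_pow]
    exact mul_le_of_le_one_right (norm_nonneg _)
      (pow_le_one₀ (norm_nonneg _) (norm_sigmoid_lt_one _).le)

theorem cexp_mul_jostV_eq (g γ : ℂ) (A x : ℝ) :
    Complex.exp ((2 * γ - 1) * (A * x : ℝ)) * jostV g γ A x =
      g⁻¹ * ((Real.sigmoid (2 * (A * x)) : ℂ) ^ γ *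
        (1 - Real.sigmoid (2 * (A * x)) : ℂ) ^ (1 - γ) *
        powerSum (derivCoeff (hypCoeff g γ)) (Real.sigmoid (2 * (A * x)))) := by
  rw [← cexp_div_cosh_eq, jostV, mul_right_comm 2 g, div_eq_mul_inv, mul_inv, div_eq_mul_inv]
  ring

theorem tendsto_jostV_atBot (g : ℂ) {γ : ℂ} (hγ : 0 < γ.re) {A : ℝ} (hA : 0 < A) :
    Tendsto (fun x : ℝ => Complex.exp ((2 * γ - 1) * (A * x : ℝ)) * jostV g γ A x) atBot (𝓝 0) := by
  obtain ⟨K, hK⟩ := exists_bound_derivCoeff_hypCoeff g hγ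
  have h0 := Real.tendsto_sigmoid_atBot.comp (tendsto_two_mul_atBot hA)
  have h1 : ContinuousAt (fun z : ℝ => (z : ℂ) ^ γ) 0 :=
    Complex.continuousAt_ofReal_cpow_const 0 γ (Or.inl hγ)
  have h2 : ContinuousAt (fun z : ℝ => (1 - z : ℂ) ^ (1 - γ)) 0 :=
    (continuousAt_const.sub Complex.continuous_ofReal.continuousAt).cpow continuousAt_const
      (by simp)
  have hne : γ ≠ 0 := by rintro rfl; simp at hγ
  have h3 := (((h1.tendsto.comp h0).mul (h2.tendsto.comp h0)).mul
    (tendsto_powerSum_sigmoid_atBot hK hA)).const_mul g⁻¹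
  simp only [Complex.ofReal_zero, Complex.zero_cpow hne, zero_mul, mul_zero] at h3
  exact h3.congr fun x => (cexp_mul_jostV_eq g γ A x).symm

/-- The reflection formula at `γ` and at `g`. For integer `g` both sides vanish, through the
convention at the pole and through the sine. -/
theorem connectionConst_eq {g : ℂ} (hg : g ≠ 0) (γ : ℂ) :
    g⁻¹ * connectionConst g γ =
      -Complex.sin (Real.pi * g) * (1 / Complex.sin (Real.pi * γ)) := by
  have h1 := Complex.Gamma_mul_Gamma_one_sub γ
  have h2 := Complex.Gamma_mul_Gamma_one_sub g
  have h3 : Complex.Gamma (1 - g) = -g * Complex.Gamma (-g) := by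
    rw [← Complex.Gamma_add_one _ (neg_ne_zero.2 hg)]
    ring_nf
  have hpi : (Real.pi : ℂ) ≠ 0 := by exact_mod_cast Real.pi_ne_zero
  have h4 : (Complex.Gamma g * Complex.Gamma (-g))⁻¹ =
      -g * Complex.sin (Real.pi * g) / Real.pi := by
    rw [h3] at h2
    have h5 : Complex.Gamma g * Complex.Gamma (-g) =
        -(Real.pi / Complex.sin (Real.pi * g)) / g := by
      rw [eq_div_iff hg]
      linear_combination -h2
    rw [h5, inv_div, div_neg, div_div_eq_mul_div]
    ring
  rw [connectionConst, mul_assoc, h1, ← mul_inv, h4]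
  field_simp

theorem tendsto_jostV_atTop {g : ℂ} (hg : g ≠ 0) {γ : ℂ} (hγ : γ.re = 1 / 2) {A : ℝ}
    (hA : 0 < A) :
    Tendsto (fun x : ℝ => Complex.exp ((2 * γ - 1) * (A * x : ℝ)) * jostV g γ A x) atTop
      (𝓝 (-Complex.sin (Real.pi * g) * (1 / Complex.sin (Real.pi * γ)))) := by
  have h0 : Tendsto (fun x : ℝ => Real.sigmoid (2 * (A * x))) atTop (𝓝[<] 1) :=
    tendsto_nhdsWithin_iff.2 ⟨Real.tendsto_sigmoid_atTop.comp (tendsto_two_mul_atTop hA),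
      Eventually.of_forall fun x => Real.sigmoid_lt_one _⟩
  have h1 := ((tendsto_derivative_hypergeometric g hγ).comp h0).const_mul g⁻¹
  rw [connectionConst_eq hg] at h1
  exact h1.congr fun x => (cexp_mul_jostV_eq g γ A x).symm

/-! ### The soliton profile is of finite density -/

theorem hasDerivAt_tanh_mul (A x : ℝ) :
    HasDerivAt (fun y : ℝ => (Real.tanh (A * y) : ℂ))
      ((A : ℂ) * (1 - (Real.tanh (A * x) : ℂ) ^ 2)) x := by
  have h1 : HasDerivAt (fun y : ℝ => A * y) A x := by simpa using (hasDerivAt_id x).const_mul A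
  have hc := (Real.cosh_pos (A * x)).ne'
  have h2 := (((Real.hasDerivAt_sinh (A * x)).comp x h1).div
    ((Real.hasDerivAt_cosh (A * x)).comp x h1) hc).ofReal_comp
  convert h2 using 1
  · ext y
    simp [Real.tanh_eq_sinh_div_cosh]
  · rw [Real.tanh_eq_sinh_div_cosh]
    norm_cast
    simp only [Function.comp]
    field_simp

theorem hasDerivAt_inv_cosh_mul (A x : ℝ) :
    HasDerivAt (fun y : ℝ => ((Real.cosh (A * y))⁻¹ : ℂ))
      (-(A : ℂ) * Real.tanh (A * x) * (Real.cosh (A * x))⁻¹) x := by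
  have h1 : HasDerivAt (fun y : ℝ => A * y) A x := by simpa using (hasDerivAt_id x).const_mul A
  have hc := (Real.cosh_pos (A * x)).ne'
  have h2 := (((Real.hasDerivAt_cosh (A * x)).comp x h1).inv hc).ofReal_comp
  convert h2 using 1
  · ext y
    simp
  · rw [Real.tanh_eq_sinh_div_cosh]
    norm_cast
    simp only [Function.comp]
    field_simp

/-- Polynomials in `tanh` times `1 / cosh` are stable under differentiation. As `tanh` is bounded,
decay of all derivatives reduces to that of `1 / cosh`. -/
theorem iteratedDeriv_sech (A : ℝ) (a : ℂ) (n : ℕ) : ∃ p : Polynomial ℂ,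
    iteratedDeriv n (fun x : ℝ => a * ((Real.cosh (A * x))⁻¹ : ℂ)) =
      fun x : ℝ => p.eval (Real.tanh (A * x) : ℂ) * ((Real.cosh (A * x))⁻¹ : ℂ) := by
  induction n with
  | zero => exact ⟨Polynomial.C a, by simp⟩
  | succ n ih =>
    obtain ⟨p, hp⟩ := ih
    refine ⟨Polynomial.C (A : ℂ) * (Polynomial.derivative p * (1 - Polynomial.X ^ 2) -
      p * Polynomial.X), ?_⟩
    rw [iteratedDeriv_succ, hp]
    ext x
    have h := ((p.hasDerivAt (Real.tanh (A * x) : ℂ)).comp x (hasDerivAt_tanh_mul A x)).mul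
      (hasDerivAt_inv_cosh_mul A x)
    refine h.deriv.trans ?_
    simp
    ring

theorem abs_pow_div_cosh_le {A : ℝ} (hA : 0 < A) (k : ℕ) (x : ℝ) :
    |x| ^ k * (Real.cosh (A * x))⁻¹ ≤ 2 * k.factorial / A ^ k := by
  have h1 := Real.pow_div_factorial_le_exp (A * |x|) (by positivity) k
  have h2 : Real.exp (A * |x|) ≤ 2 * Real.cosh (A * x) := by
    rw [← Real.cosh_abs, abs_mul, abs_of_pos hA, Real.cosh_eq]
    have := Real.exp_pos (-(A * |x|))
    linarith
  have hc := Real.cosh_pos (A * x)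
  have h3 : (0 : ℝ) < k.factorial := by exact_mod_cast k.factorial_pos
  rw [← div_eq_mul_inv, div_le_div_iff₀ hc (by positivity)]
  rw [div_le_iff₀ h3, mul_pow] at h1
  nlinarith [mul_le_mul_of_nonneg_right h2 h3.le]

/-- The function `x ↦ a / cosh (A x)` as a Schwartz function. -/
def sechSchwartz {A : ℝ} (hA : 0 < A) (a : ℂ) : 𝓢(ℝ, ℂ) where
  toFun x := a * ((Real.cosh (A * x))⁻¹ : ℂ)
  smooth' := by
    have h : ContDiff ℝ ((⊤ : ℕ∞) : WithTop ℕ∞) fun x : ℝ => (Real.cosh (A * x))⁻¹ :=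
      (Real.contDiff_cosh.comp (contDiff_const.mul contDiff_id)).inv
        fun x => (Real.cosh_pos _).ne'
    have h2 := (contDiff_const (c := a)).mul (Complex.ofRealCLM.contDiff.comp h)
    have e : (fun x : ℝ => a * ((Real.cosh (A * x))⁻¹ : ℂ)) =
        fun x : ℝ => a * (Complex.ofRealCLM ∘ fun x : ℝ => (Real.cosh (A * x))⁻¹) x := by
      ext x
      simp
    rw [e]
    exact h2
  decay' k n := by
    obtain ⟨p, hp⟩ := iteratedDeriv_sech A a n
    obtain ⟨M, hM⟩ := (isCompact_Icc (a := (-1 : ℝ)) (b := 1)).exists_bound_of_continuousOn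
      (f := fun y : ℝ => p.eval (y : ℂ))
      ((p.continuous.comp Complex.continuous_ofReal).continuousOn)
    refine ⟨M * (2 * k.factorial / A ^ k), fun x => ?_⟩
    have h1 := hM (Real.tanh (A * x)) ⟨(Real.neg_one_lt_tanh _).le, (Real.tanh_lt_one _).le⟩
    have h2 := abs_pow_div_cosh_le hA k x
    rw [norm_iteratedFDeriv_eq_norm_iteratedDeriv, hp, norm_mul, norm_inv, Complex.norm_real,
      Real.norm_of_nonneg (Real.cosh_pos _).le, Real.norm_eq_abs, mul_left_comm]
    have := Real.cosh_pos (A * x)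
    have hM0 : 0 ≤ M := (norm_nonneg _).trans h1
    gcongr

theorem isFiniteDensity_solitonProfile {A : ℝ} (hA : 0 < A) :
    IsFiniteDensity (solitonProfile A) := by
  refine ⟨sechSchwartz hA (-(Complex.I * A)), fun x => ?_⟩
  change _ = 1 + -(Complex.I * A) * ((Real.cosh (A * x))⁻¹ : ℂ)
  rw [solitonProfile]
  ring

/-! ### Wronskians and uniqueness of the scattering matrix -/

/-- `Ψ` solves the matrix equation `Ψₓ + i k σ₃ Ψ = W Ψ`. -/
def SolvesAuxiliary (c : ℂ) (q : ℝ → ℂ) (k : ℝ) (Ψ : ℝ → Matrix (Fin 2) (Fin 2) ℂ) : Prop :=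
  ∀ (x : ℝ) (i j : Fin 2), HasDerivAt (fun y => Ψ y i j)
    (((-(Complex.I * (k : ℂ))) • sigma3 * Ψ x + W c q x * Ψ x) i j) x

/-- Up to sign the entries are Wronskians of a column of `Ψ` with a column of `χ`, constant because
the coefficient matrix is traceless. This yields both the constancy of determinants and the
uniqueness of solutions. -/
theorem SolvesAuxiliary.adjugate_mul_eq {c : ℂ} {q : ℝ → ℂ} {k : ℝ}
    {Ψ χ : ℝ → Matrix (Fin 2) (Fin 2) ℂ} (hΨ : SolvesAuxiliary c q k Ψ)
    (hχ : SolvesAuxiliary c q k χ) (x y : ℝ) :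
    (Ψ x).adjugate * χ x = (Ψ y).adjugate * χ y := by
  have h : ∀ (a : Fin 2) (j : Fin 2) (x : ℝ),
      HasDerivAt (fun x => Ψ x 1 a * χ x 0 j - Ψ x 0 a * χ x 1 j) 0 x := by
    intro a j x
    refine (((hΨ x 1 a).mul (hχ x 0 j)).sub ((hΨ x 0 a).mul (hχ x 1 j))).congr_deriv ?_
    simp [sigma3, W, Matrix.vecMul, dotProduct, Fin.sum_univ_two]
    ring
  have hc : ∀ (a j : Fin 2), Ψ x 1 a * χ x 0 j - Ψ x 0 a * χ x 1 j =
      Ψ y 1 a * χ y 0 j - Ψ y 0 a * χ y 1 j := fun a j =>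
    is_const_of_deriv_eq_zero (fun z => (h a j z).differentiableAt) (fun z => (h a j z).deriv) x y
  ext i j
  have h0 := hc 0 j
  have h1 := hc 1 j
  fin_cases i
  · simp [Matrix.mul_apply, Fin.sum_univ_two, Matrix.adjugate_fin_two]
    linear_combination h1
  · simp [Matrix.mul_apply, Fin.sum_univ_two, Matrix.adjugate_fin_two]
    linear_combination -h0

theorem SolvesAuxiliary.det_eq {c : ℂ} {q : ℝ → ℂ} {k : ℝ}
    {Ψ : ℝ → Matrix (Fin 2) (Fin 2) ℂ} (hΨ : SolvesAuxiliary c q k Ψ) (x y : ℝ) :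
    (Ψ x).det = (Ψ y).det := by
  have h := hΨ.adjugate_mul_eq hΨ x y
  rw [Matrix.adjugate_mul, Matrix.adjugate_mul] at h
  simpa using congrFun (congrFun h 0) 0

theorem SolvesAuxiliary.mul_const {c : ℂ} {q : ℝ → ℂ} {k : ℝ}
    {Ψ : ℝ → Matrix (Fin 2) (Fin 2) ℂ} (hΨ : SolvesAuxiliary c q k Ψ)
    (K : Matrix (Fin 2) (Fin 2) ℂ) : SolvesAuxiliary c q k fun x => Ψ x * K := by
  intro x i j
  have h := ((hΨ x i 0).mul_const (K 0 j)).add ((hΨ x i 1).mul_const (K 1 j))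
  have e : ((-(Complex.I * (k : ℂ))) • sigma3 * (Ψ x * K) + W c q x * (Ψ x * K)) i j =
      ((-(Complex.I * (k : ℂ))) • sigma3 * Ψ x + W c q x * Ψ x) i 0 * K 0 j +
      ((-(Complex.I * (k : ℂ))) • sigma3 * Ψ x + W c q x * Ψ x) i 1 * K 1 j := by
    rw [← Matrix.mul_assoc, ← Matrix.mul_assoc, ← Matrix.add_mul, Matrix.mul_apply,
      Fin.sum_univ_two]
  rw [e]
  simpa [Matrix.mul_apply, Fin.sum_univ_two] using! h

theorem SolvesAuxiliary.eq_mul_const {c : ℂ} {q : ℝ → ℂ} {k : ℝ}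
    {Ψ χ : ℝ → Matrix (Fin 2) (Fin 2) ℂ} (hΨ : SolvesAuxiliary c q k Ψ)
    (hχ : SolvesAuxiliary c q k χ) (hdet : ∀ x, (Ψ x).det ≠ 0) (x : ℝ) :
    χ x = Ψ x * ((Ψ 0)⁻¹ * χ 0) := by
  have h := hΨ.adjugate_mul_eq hχ x 0
  have hu : ∀ y, (Ψ y).adjugate = (Ψ 0).det • (Ψ y)⁻¹ := by
    intro y
    rw [Matrix.inv_def, hΨ.det_eq y 0, smul_smul, Ring.inverse_eq_inv',
      mul_inv_cancel₀ (hdet 0), one_smul]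
  rw [hu, hu, Matrix.smul_mul, Matrix.smul_mul] at h
  have h2 := smul_right_injective _ (hdet 0) h
  rw [← h2, Matrix.mul_nonsing_inv_cancel_left _ _ (isUnit_iff_ne_zero.2 (hdet x))]

theorem det_E (c : ℂ) (k x : ℝ) : (E c k x).det = (P c k).det := by
  rw [E, Matrix.det_mul, Matrix.det_fin_two_of, ← Complex.exp_add]
  simp

theorem IsJost.solvesAuxiliary {c : ℂ} {q : ℝ → ℂ} {k : ℝ} {l : Filter ℝ}
    {Ψ : ℝ → Matrix (Fin 2) (Fin 2) ℂ} (h : IsJost c q k l Ψ) : SolvesAuxiliary c q k Ψ := h.ode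

/-- If `E⁻¹ Ψ⁻ → M` at `+∞`, then `adj M` is the one and only scattering matrix. -/
theorem isScatteringMatrix_iff {c : ℂ} {q : ℝ → ℂ} {k : ℝ}
    {Ψ : ℝ → Matrix (Fin 2) (Fin 2) ℂ} (hΨ : IsJost c q k atBot Ψ)
    {M : Matrix (Fin 2) (Fin 2) ℂ}
    (hM : Tendsto (fun x => (E c k x)⁻¹ * Ψ x) atTop (𝓝 M)) (S : Matrix (Fin 2) (Fin 2) ℂ) :
    IsScatteringMatrix c q k S ↔ S = M.adjugate := by
  have hsol := hΨ.solvesAuxiliary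
  have hcontdet : Continuous fun N : Matrix (Fin 2) (Fin 2) ℂ => N.det := continuous_id.matrix_det
  have hdetE : ∀ x, ((E c k x)⁻¹ * Ψ x).det = ((P c k).det)⁻¹ * (Ψ 0).det := by
    intro x
    rw [Matrix.det_mul, Matrix.det_nonsing_inv, det_E, hsol.det_eq x 0, Ring.inverse_eq_inv']
  -- The determinant of `E⁻¹ Ψ` does not depend on `x`, so its limit `1` at `-∞` is its value
  -- everywhere, hence also `det M`. In particular `Ψ` is invertible and `adj M = M⁻¹`.
  have hone : ((P c k).det)⁻¹ * (Ψ 0).det = 1 := by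
    have h := (hcontdet.tendsto 1).comp hΨ.normalization
    simp only [Function.comp_def, hdetE, Matrix.det_one] at h
    exact tendsto_nhds_unique tendsto_const_nhds h
  have hMdet : M.det = 1 := by
    have h := (hcontdet.tendsto M).comp hM
    simp only [Function.comp_def, hdetE, hone] at h
    exact tendsto_nhds_unique h tendsto_const_nhds
  have hdet : ∀ x, (Ψ x).det ≠ 0 := by
    intro x
    rw [hsol.det_eq x 0]
    intro h
    rw [h, mul_zero] at hone
    exact zero_ne_one hone
  have hMadj : M * M.adjugate = 1 := by rw [Matrix.mul_adjugate, hMdet, one_smul]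
  have hMadj' : M.adjugate * M = 1 := by rw [Matrix.adjugate_mul, hMdet, one_smul]
  have hcontmul : ∀ K : Matrix (Fin 2) (Fin 2) ℂ,
      Continuous fun N : Matrix (Fin 2) (Fin 2) ℂ => N * K := fun K =>
    continuous_id.matrix_mul continuous_const
  constructor
  · rintro ⟨Ψp, Ψm, hp, hm, hS⟩
    have e1 := hsol.eq_mul_const hm.solvesAuxiliary hdet
    have e2 := hsol.eq_mul_const hp.solvesAuxiliary hdet
    -- Any pair of Jost solutions is `Ψ K1`, `Ψ K2`; normalisation at the two ends forces `K1 = 1`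
    -- and `M K2 = 1`.
    set K1 := (Ψ 0)⁻¹ * Ψm 0
    set K2 := (Ψ 0)⁻¹ * Ψp 0
    have h1 : K1 = 1 := by
      have h := ((hcontmul K1).tendsto 1).comp hΨ.normalization
      simp only [Function.comp_def, Matrix.mul_assoc, ← e1, Matrix.one_mul] at h
      exact tendsto_nhds_unique h hm.normalization
    have h2 : M * K2 = 1 := by
      have h := ((hcontmul K2).tendsto M).comp hM
      simp only [Function.comp_def, Matrix.mul_assoc, ← e2] at h
      exact tendsto_nhds_unique h hp.normalization
    have h3 : K2 = S := by
      have h := hS 0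
      rw [e1 0, e2 0, h1, Matrix.mul_one] at h
      have h4 := congrArg (fun N => (Ψ 0)⁻¹ * N) h
      simpa [Matrix.nonsing_inv_mul_cancel_left _ _ (isUnit_iff_ne_zero.2 (hdet 0))] using h4
    rw [← h3, ← Matrix.one_mul K2, ← hMadj', Matrix.mul_assoc, h2, Matrix.mul_one]
  · rintro rfl
    refine ⟨fun x => Ψ x * M.adjugate, Ψ, ⟨hsol.mul_const _, ?_⟩, hΨ, fun x => rfl⟩
    have h := ((hcontmul M.adjugate).tendsto M).comp hM
    simpa only [Function.comp_def, Matrix.mul_assoc, hMadj] using! h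

/-! ### Couplings and conjugation by `P` -/

theorem IsCoupling.ne_zero {c : ℂ} (hc : IsCoupling c) : c ≠ 0 := by
  obtain ⟨r, hr, rfl | rfl⟩ := hc
  · exact_mod_cast hr.ne'
  · exact mul_ne_zero Complex.I_ne_zero (by exact_mod_cast hr.ne')

theorem IsCoupling.ofReal_sq_re {c : ℂ} (hc : IsCoupling c) : (((c ^ 2).re : ℝ) : ℂ) = c ^ 2 := by
  obtain ⟨r, hr, rfl | rfl⟩ := hc
  · norm_cast
  · rw [mul_pow, Complex.I_sq, ← Complex.ofReal_pow, ← Complex.ofReal_one, ← Complex.ofReal_neg,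
      ← Complex.ofReal_mul, Complex.ofReal_re]

theorem IsCoupling.conj_cases {c g : ℂ} (hc : IsCoupling c) (hg : c = Complex.I * g) :
    (starRingEnd ℂ g = g ∧ starRingEnd ℂ c / c = -1) ∨
      (starRingEnd ℂ g = -g ∧ starRingEnd ℂ c / c = 1) := by
  have hne := hc.ne_zero
  obtain ⟨r, hr, h | h⟩ := hc
  · right
    have e : starRingEnd ℂ c = c := by rw [h, Complex.conj_ofReal]
    refine ⟨?_, by rw [e, div_self hne]⟩
    have h2 := e
    rw [hg, map_mul, Complex.conj_I] at h2
    refine mul_left_cancel₀ Complex.I_ne_zero ?_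
    linear_combination -h2
  · left
    have e : g = r := mul_left_cancel₀ Complex.I_ne_zero (hg.symm.trans h)
    refine ⟨by rw [e, Complex.conj_ofReal], ?_⟩
    rw [h, map_mul, Complex.conj_I, Complex.conj_ofReal, ← h, neg_mul, ← h, neg_div, div_self hne]

theorem mu_pos {c : ℂ} {k : ℝ} (hk : k ∈ spectralSet c) : 0 < mu c k := Real.sqrt_pos.2 hk

theorem mu_sq {c : ℂ} (hc : IsCoupling c) {k : ℝ} (hk : k ∈ spectralSet c) :
    (mu c k : ℂ) ^ 2 = (k : ℂ) ^ 2 - c ^ 2 := by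
  rw [← hc.ofReal_sq_re, ← Complex.ofReal_pow, mu, Real.sq_sqrt (le_of_lt hk)]
  push_cast
  ring

theorem det_P_ne_zero {c : ℂ} (hc : IsCoupling c) {k : ℝ} (hk : k ∈ spectralSet c) :
    (P c k).det ≠ 0 := by
  have hne := hc.ne_zero
  have hmu := mu_sq hc hk
  have hpos : (mu c k : ℂ) ≠ 0 := by exact_mod_cast (mu_pos hk).ne'
  rw [P, Matrix.det_fin_two_of]
  intro h
  field_simp at h
  rw [Complex.I_sq] at h
  -- Since `μ² = k² - c²`, one has `c² det P = 2 μ (k - μ)`, so a vanishing determinant would give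
  -- `μ = k` and then `c = 0`.
  have h1 : (mu c k : ℂ) = k := mul_left_cancel₀ hpos (by linear_combination (hmu - h) / 2)
  rw [h1] at hmu
  have : c ^ 2 = 0 := by linear_combination hmu
  exact hne (pow_eq_zero_iff two_ne_zero |>.1 this)

/-- The coefficient matrix of the auxiliary problem after conjugation by `P`. -/
def reducedMatrix (g : ℂ) (A m x : ℝ) : Matrix (Fin 2) (Fin 2) ℂ :=
  !![-(Complex.I * m), g * A / Real.cosh (A * x); -(g * A / Real.cosh (A * x)), Complex.I * m]

/-- The soliton part of `W` is `g A / cosh (A x)` times `J = (0, 1; -1, 0)` and commutes with `P = 1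
+ αJ`. The constant part is diagonalised by `P` because `(μ - k)(μ + k) = -c²`. -/
theorem auxiliary_mul_P {c g : ℂ} (hc : IsCoupling c) (hg : c = Complex.I * g) {k : ℝ}
    (hk : k ∈ spectralSet c) (A x : ℝ) :
    ((-(Complex.I * (k : ℂ))) • sigma3 + W c (solitonProfile A) x) * P c k =
      P c k * reducedMatrix g A (mu c k) x := by
  have hne := hc.ne_zero
  have hmu := mu_sq hc hk
  have hα : c * (Complex.I * ((mu c k : ℂ) - k) / c) = Complex.I * ((mu c k : ℂ) - k) := by
    field_simp
  have hβ : Complex.I * (Complex.I * ((mu c k : ℂ) - k) / c) * ((mu c k : ℂ) + k) = c := by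
    field_simp
    rw [Complex.I_sq]
    linear_combination -hmu
  have hs : starRingEnd ℂ (solitonProfile A x) =
      1 + Complex.I * ((A : ℂ) / Real.cosh (A * x)) := by
    rw [solitonProfile]
    simp only [map_sub, map_one, map_div₀, map_mul, Complex.conj_I, Complex.conj_ofReal]
    ring
  have hs' : solitonProfile A x = 1 - Complex.I * ((A : ℂ) / Real.cosh (A * x)) := by
    rw [solitonProfile]
    ring
  have hgs : g * A / Real.cosh (A * x) = -Complex.I * c * ((A : ℂ) / Real.cosh (A * x)) := by
    rw [hg, ← mul_assoc, neg_mul, Complex.I_mul_I]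
    ring
  rw [W, hs, hs', reducedMatrix, hgs, P, sigma3]
  generalize (A : ℂ) / Real.cosh (A * x) = s at *
  generalize Complex.I * ((mu c k : ℂ) - k) / c = α at *
  ext i j
  fin_cases i <;> fin_cases j <;>
    simp [Matrix.mul_apply, Fin.sum_univ_two]
  · linear_combination -hα
  · linear_combination -hβ
  · linear_combination -hβ
  · linear_combination hα

/-! ### The scattering matrix of the soliton profile -/

/-- The parameter `1/2 - i m / A` of the hypergeometric series. -/
def hypParam (A m : ℝ) : ℂ := 1 / 2 - Complex.I * m / A

theorem hypParam_re (A m : ℝ) : (hypParam A m).re = 1 / 2 := by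
  have : hypParam A m = ((1 / 2 : ℝ) : ℂ) - ((m / A : ℝ) : ℂ) * Complex.I := by
    rw [hypParam]
    push_cast
    ring
  rw [this]
  simp

/-- The fundamental matrix of the reduced problem normalised at `-∞`. -/
def reducedSolution (g : ℂ) (A m x : ℝ) : Matrix (Fin 2) (Fin 2) ℂ :=
  !![Complex.exp (-(Complex.I * m * x)) * jostU g (hypParam A m) A x,
      -(Complex.exp (Complex.I * m * x) * jostV g (hypParam A (-m)) A x);
    Complex.exp (-(Complex.I * m * x)) * jostV g (hypParam A m) A x,
      Complex.exp (Complex.I * m * x) * jostU g (hypParam A (-m)) A x]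

theorem hasDerivAt_cexp_mul (a : ℂ) (x : ℝ) :
    HasDerivAt (fun y : ℝ => Complex.exp (a * y)) (a * Complex.exp (a * x)) x := by
  have h1 : HasDerivAt (fun y : ℝ => a * (y : ℂ)) a x := by
    simpa using (Complex.ofRealCLM.hasDerivAt (x := x)).const_mul a
  simpa [mul_comm] using h1.cexp

/-- The factor `exp (-imx)` restores the diagonal terms, as `(1 - 2γ) A = 2im`. The second column
comes from the first by the symmetry `(u, v, m) ↦ (-v, u, -m)` of the reduced system. -/
theorem hasDerivAt_reducedSolution {g : ℂ} (hg : g ≠ 0) {A : ℝ} (hA : A ≠ 0) (m x : ℝ)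
    (i j : Fin 2) :
    HasDerivAt (fun y => reducedSolution g A m y i j)
      ((reducedMatrix g A m x * reducedSolution g A m x) i j) x := by
  have hA' : (A : ℂ) ≠ 0 := by exact_mod_cast hA
  have hp : ∀ m : ℝ, 0 < (hypParam A m).re := fun m => by rw [hypParam_re]; norm_num
  have hκ : ∀ m : ℝ, (1 - 2 * hypParam A m) * A = 2 * (Complex.I * m) := fun m => by
    rw [hypParam]
    field_simp
    ring
  have hU := fun m : ℝ => hasDerivAt_jostU hg (hp m) A x
  have hV := fun m : ℝ => hasDerivAt_jostV hg (hp m) A x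
  simp only [hκ] at hV
  have h1 := hasDerivAt_cexp_mul (-(Complex.I * m)) x
  have h2 := hasDerivAt_cexp_mul (Complex.I * m) x
  simp only [neg_mul] at h1
  fin_cases i <;> fin_cases j
  · refine (h1.mul (hU m)).congr_deriv ?_
    simp [reducedMatrix, reducedSolution]
    ring
  · refine (h2.mul (hV (-m))).neg.congr_deriv ?_
    simp [reducedMatrix, reducedSolution]
    ring
  · refine (h1.mul (hV m)).congr_deriv ?_
    simp [reducedMatrix, reducedSolution]
    ring
  · refine (h2.mul (hU (-m))).congr_deriv ?_
    simp [reducedMatrix, reducedSolution]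
    ring

theorem solvesAuxiliary_soliton {c g : ℂ} (hc : IsCoupling c) (hg : c = Complex.I * g) {A : ℝ}
    (hA : A ≠ 0) {k : ℝ} (hk : k ∈ spectralSet c) :
    SolvesAuxiliary c (solitonProfile A) k
      fun x => P c k * reducedSolution g A (mu c k) x := by
  have hg0 : g ≠ 0 := by
    rintro rfl
    exact hc.ne_zero (by simpa using hg)
  intro x i j
  have h := ((hasDerivAt_reducedSolution hg0 hA (mu c k) x 0 j).const_mul (P c k i 0)).add
    ((hasDerivAt_reducedSolution hg0 hA (mu c k) x 1 j).const_mul (P c k i 1))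
  have e : ((-(Complex.I * (k : ℂ))) • sigma3 * (P c k * reducedSolution g A (mu c k) x) +
      W c (solitonProfile A) x * (P c k * reducedSolution g A (mu c k) x)) i j =
      P c k i 0 * (reducedMatrix g A (mu c k) x * reducedSolution g A (mu c k) x) 0 j +
      P c k i 1 * (reducedMatrix g A (mu c k) x * reducedSolution g A (mu c k) x) 1 j := by
    rw [← Matrix.add_mul, ← Matrix.mul_assoc, auxiliary_mul_P hc hg hk, Matrix.mul_assoc,
      Matrix.mul_apply, Fin.sum_univ_two]
  rw [e]
  simpa [Matrix.mul_apply, Fin.sum_univ_two] using! h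

theorem E_inv_mul {c : ℂ} (hc : IsCoupling c) (g : ℂ) {A : ℝ} (hA : A ≠ 0) {k : ℝ}
    (hk : k ∈ spectralSet c) (x : ℝ) :
    (E c k x)⁻¹ * (P c k * reducedSolution g A (mu c k) x) =
      !![jostU g (hypParam A (mu c k)) A x,
          -(Complex.exp ((2 * hypParam A (-mu c k) - 1) * (A * x : ℝ)) *
            jostV g (hypParam A (-mu c k)) A x);
        Complex.exp ((2 * hypParam A (mu c k) - 1) * (A * x : ℝ)) *
            jostV g (hypParam A (mu c k)) A x,
          jostU g (hypParam A (-mu c k)) A x] := by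
  have hA' : (A : ℂ) ≠ 0 := by exact_mod_cast hA
  set m := mu c k
  have e1 : (2 * hypParam A (-m) - 1) * ((A * x : ℝ) : ℂ) =
      Complex.I * m * x + Complex.I * m * x := by
    rw [hypParam]
    push_cast
    field_simp
    ring
  have e2 : (2 * hypParam A m - 1) * ((A * x : ℝ) : ℂ) =
      -(Complex.I * m * x) + -(Complex.I * m * x) := by
    rw [hypParam]
    push_cast
    field_simp
    ring
  have hD : (!![Complex.exp (-(Complex.I * m * x)), 0; 0, Complex.exp (Complex.I * m * x)])⁻¹ =
      !![Complex.exp (Complex.I * m * x), 0; 0, Complex.exp (-(Complex.I * m * x))] := by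
    refine Matrix.inv_eq_left_inv ?_
    ext i j
    fin_cases i <;> fin_cases j <;> simp [← Complex.exp_add]
  rw [E, Matrix.mul_inv_rev, Matrix.mul_assoc,
    Matrix.nonsing_inv_mul_cancel_left _ _ (isUnit_iff_ne_zero.2 (det_P_ne_zero hc hk)), hD, e1, e2,
    Complex.exp_add, Complex.exp_add, reducedSolution]
  have h : Complex.exp (Complex.I * m * x) * Complex.exp (-(Complex.I * m * x)) = 1 := by
    rw [← Complex.exp_add]
    simp
  ext i j
  fin_cases i <;> fin_cases j <;> simp
  · rw [← mul_assoc, h, one_mul]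
  · ring
  · ring
  · rw [← mul_assoc, mul_comm (Complex.exp _), h, one_mul]

theorem sin_pi_mul_hypParam (A m : ℝ) :
    Complex.sin (Real.pi * hypParam A m) = Complex.cosh (Real.pi * m / A) := by
  rw [← Complex.cos_mul_I, ← Complex.sin_pi_div_two_sub, hypParam]
  congr 1
  ring

theorem isScatteringMatrix_soliton_iff {c g : ℂ} (hc : IsCoupling c) (hg : c = Complex.I * g)
    {A : ℝ} (hA : 0 < A) {k : ℝ} (hk : k ∈ spectralSet c) (S : Matrix (Fin 2) (Fin 2) ℂ) :
    IsScatteringMatrix c (solitonProfile A) k S ↔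
      S = !![Complex.Gamma (hypParam A (-mu c k)) ^ 2 /
          (Complex.Gamma (hypParam A (-mu c k) - g) * Complex.Gamma (hypParam A (-mu c k) + g)),
        -Complex.sin (Real.pi * g) * (1 / Complex.cosh (Real.pi * mu c k / A));
        Complex.sin (Real.pi * g) * (1 / Complex.cosh (Real.pi * mu c k / A)),
        Complex.Gamma (hypParam A (mu c k)) ^ 2 /
          (Complex.Gamma (hypParam A (mu c k) - g) * Complex.Gamma (hypParam A (mu c k) + g))] := by
  have hg0 : g ≠ 0 := by
    rintro rfl
    exact hc.ne_zero (by simpa using hg)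
  have hp : ∀ m : ℝ, 0 < (hypParam A m).re := fun m => by rw [hypParam_re]; norm_num
  have hbot : Tendsto (fun x => (E c k x)⁻¹ * (P c k * reducedSolution g A (mu c k) x)) atBot
      (𝓝 1) := by
    simp only [E_inv_mul hc g hA.ne' hk]
    refine tendsto_pi_nhds.2 fun i => tendsto_pi_nhds.2 fun j => ?_
    fin_cases i <;> fin_cases j
    · simpa using! tendsto_jostU_atBot g (hp (mu c k)) hA
    · simpa using! (tendsto_jostV_atBot g (hp (-mu c k)) hA).neg
    · simpa using! tendsto_jostV_atBot g (hp (mu c k)) hA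
    · simpa using! tendsto_jostU_atBot g (hp (-mu c k)) hA
  have htop : Tendsto (fun x => (E c k x)⁻¹ * (P c k * reducedSolution g A (mu c k) x)) atTop
      (𝓝 !![Complex.Gamma (hypParam A (mu c k)) ^ 2 /
          (Complex.Gamma (hypParam A (mu c k) - g) * Complex.Gamma (hypParam A (mu c k) + g)),
        -(-Complex.sin (Real.pi * g) * (1 / Complex.sin (Real.pi * hypParam A (-mu c k))));
        -Complex.sin (Real.pi * g) * (1 / Complex.sin (Real.pi * hypParam A (mu c k))),
        Complex.Gamma (hypParam A (-mu c k)) ^ 2 /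
          (Complex.Gamma (hypParam A (-mu c k) - g) *
            Complex.Gamma (hypParam A (-mu c k) + g))]) := by
    simp only [E_inv_mul hc g hA.ne' hk]
    refine tendsto_pi_nhds.2 fun i => tendsto_pi_nhds.2 fun j => ?_
    fin_cases i <;> fin_cases j
    · exact tendsto_jostU_atTop g (hp (mu c k)) hA
    · exact (tendsto_jostV_atTop hg0 (hypParam_re A (-mu c k)) hA).neg
    · exact tendsto_jostV_atTop hg0 (hypParam_re A (mu c k)) hA
    · exact tendsto_jostU_atTop g (hp (-mu c k)) hA
  rw [isScatteringMatrix_iff ⟨solvesAuxiliary_soliton hc hg hA.ne' hk, hbot⟩ htop,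
    Matrix.adjugate_fin_two_of, sin_pi_mul_hypParam, sin_pi_mul_hypParam, Complex.ofReal_neg,
    mul_neg, neg_div, Complex.cosh_neg, neg_neg, neg_mul, neg_neg]

/-! ### Conjugation symmetry and the special case `g = 1` -/

theorem conj_hypParam (A m : ℝ) : starRingEnd ℂ (hypParam A m) = hypParam A (-m) := by
  simp only [hypParam, map_sub, map_div₀, map_mul, map_one, Complex.conj_I, Complex.conj_ofReal,
    map_ofNat, Complex.ofReal_neg]
  ring

theorem hasScatteringData_solitonProfile {c g : ℂ} (hc : IsCoupling c) (hg : c = Complex.I * g)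
    {A : ℝ} (hA : 0 < A) :
    HasScatteringData c (solitonProfile A)
      (fun k => Complex.Gamma (1 / 2 - Complex.I * (mu c k : ℂ) / (A : ℂ)) ^ 2 /
        (Complex.Gamma (1 / 2 - g - Complex.I * (mu c k : ℂ) / (A : ℂ)) *
          Complex.Gamma (1 / 2 + g - Complex.I * (mu c k : ℂ) / (A : ℂ))))
      (fun k => -Complex.sin ((Real.pi : ℂ) * g) *
        (1 / Complex.cosh ((Real.pi : ℂ) * (mu c k : ℂ) / (A : ℂ)))) := by
  intro k hk S
  rw [isScatteringMatrix_soliton_iff hc hg hA hk]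
  have e1 : (1 / 2 - Complex.I * (mu c k : ℂ) / (A : ℂ)) = hypParam A (mu c k) := rfl
  have e2 : 1 / 2 - g - Complex.I * (mu c k : ℂ) / (A : ℂ) = hypParam A (mu c k) - g := by
    rw [hypParam]
    ring
  have e3 : 1 / 2 + g - Complex.I * (mu c k : ℂ) / (A : ℂ) = hypParam A (mu c k) + g := by
    rw [hypParam]
    ring
  beta_reduce
  rw [e1, e2, e3]
  have hcosh : starRingEnd ℂ (Complex.cosh (Real.pi * mu c k / A)) =
      Complex.cosh (Real.pi * mu c k / A) := by
    rw [← Complex.cosh_conj]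
    simp
  -- Conjugation sends `μ` to `-μ` in the Gamma parameter; for imaginary `g` it also changes the
  -- sign of `g`, which only swaps the two factors of the denominator.
  have ha : starRingEnd ℂ (Complex.Gamma (hypParam A (mu c k)) ^ 2 /
      (Complex.Gamma (hypParam A (mu c k) - g) * Complex.Gamma (hypParam A (mu c k) + g))) =
      Complex.Gamma (hypParam A (-mu c k)) ^ 2 /
      (Complex.Gamma (hypParam A (-mu c k) - g) * Complex.Gamma (hypParam A (-mu c k) + g)) := by
    simp only [map_div₀, map_pow, map_mul, ← Complex.Gamma_conj, map_sub, map_add, conj_hypParam]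
    rcases hc.conj_cases hg with ⟨h, -⟩ | ⟨h, -⟩
    · rw [h]
    · rw [h, sub_neg_eq_add, ← sub_eq_add_neg, mul_comm (Complex.Gamma (_ + g))]
  -- The sine is real when `c*/c = -1` and changes sign under conjugation when `c*/c = 1`, so both
  -- cases give the same entry.
  have hb : starRingEnd ℂ c / c * starRingEnd ℂ (-Complex.sin (Real.pi * g) *
      (1 / Complex.cosh (Real.pi * mu c k / A))) =
      Complex.sin (Real.pi * g) * (1 / Complex.cosh (Real.pi * mu c k / A)) := by
    rw [map_mul, map_neg, map_div₀, map_one, hcosh, ← Complex.sin_conj, map_mul,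
      Complex.conj_ofReal]
    rcases hc.conj_cases hg with ⟨h, h'⟩ | ⟨h, h'⟩
    · rw [h, h']
      ring
    · rw [h, h', mul_neg, Complex.sin_neg]
      ring
  rw [ha, hb]

/-- The functional equation collapses the quotient to `(γ - 1) / γ`, and `iAγ = m + iA/2`. -/
theorem gamma_ratio_one (A m : ℝ) (hA : 0 < A) :
    Complex.Gamma (1 / 2 - Complex.I * (m : ℂ) / (A : ℂ)) ^ 2 /
      (Complex.Gamma (1 / 2 - 1 - Complex.I * (m : ℂ) / (A : ℂ)) *
        Complex.Gamma (1 / 2 + 1 - Complex.I * (m : ℂ) / (A : ℂ))) =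
    ((m : ℂ) - Complex.I * (A : ℂ) / 2) / ((m : ℂ) + Complex.I * (A : ℂ) / 2) := by
  have hA' : (A : ℂ) ≠ 0 := by exact_mod_cast hA.ne'
  have hre := hypParam_re A m
  have e1 : (1 / 2 - Complex.I * (m : ℂ) / (A : ℂ)) = hypParam A m := rfl
  have e2 : 1 / 2 - 1 - Complex.I * (m : ℂ) / (A : ℂ) = hypParam A m - 1 := by
    rw [hypParam]
    ring
  have e3 : 1 / 2 + 1 - Complex.I * (m : ℂ) / (A : ℂ) = hypParam A m + 1 := by
    rw [hypParam]
    ring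
  have h0 : hypParam A m ≠ 0 := by
    intro h
    rw [h] at hre
    norm_num at hre
  have h1 : hypParam A m - 1 ≠ 0 := by
    intro h
    rw [sub_eq_zero.1 h] at hre
    norm_num at hre
  have hG : Complex.Gamma (hypParam A m) ≠ 0 :=
    Complex.Gamma_ne_zero_of_re_pos (by rw [hre]; norm_num)
  have h2 : Complex.Gamma (hypParam A m) =
      (hypParam A m - 1) * Complex.Gamma (hypParam A m - 1) := by
    rw [← Complex.Gamma_add_one _ h1, sub_add_cancel]
  have hG' : Complex.Gamma (hypParam A m - 1) ≠ 0 := by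
    intro h
    rw [h, mul_zero] at h2
    exact hG h2
  have h3 : (m : ℂ) - Complex.I * A / 2 = Complex.I * A * (hypParam A m - 1) := by
    rw [hypParam]
    field_simp
    linear_combination (2 * (m : ℂ)) * Complex.I_sq
  have h4 : (m : ℂ) + Complex.I * A / 2 = Complex.I * A * hypParam A m := by
    rw [hypParam]
    field_simp
    linear_combination (2 * (m : ℂ)) * Complex.I_sq
  rw [e1, e2, e3, h3, h4, mul_div_mul_left _ _ (mul_ne_zero Complex.I_ne_zero hA'),
    Complex.Gamma_add_one _ h0, div_eq_div_iff (by positivity) h0]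
  nth_rewrite 1 [sq, h2]
  ring

theorem hasScatteringData_I_solitonProfile {A : ℝ} (hA : 0 < A) :
    HasScatteringData Complex.I (solitonProfile A)
      (fun k => ((mu Complex.I k : ℂ) - Complex.I * (A : ℂ) / 2) /
        ((mu Complex.I k : ℂ) + Complex.I * (A : ℂ) / 2))
      (fun _ => 0) := by
  have h := hasScatteringData_solitonProfile (c := Complex.I) (g := 1)
    ⟨1, one_pos, Or.inr (by simp)⟩ (by simp) hA
  simpa only [gamma_ratio_one A _ hA, mul_one, Complex.sin_pi, neg_zero, zero_mul] using h

/-- `(π / A) (iA / 2) = iπ/2`, and `sinh (y - iπ/2) = -i cosh y`. -/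
theorem sinh_shift (A m : ℝ) (hA : 0 < A) :
    Complex.I / Complex.sinh ((Real.pi : ℂ) / (A : ℂ) * ((m : ℂ) - Complex.I * (A : ℂ) / 2)) =
      -(1 / Complex.cosh ((Real.pi : ℂ) * (m : ℂ) / (A : ℂ))) := by
  have hA' : (A : ℂ) ≠ 0 := by exact_mod_cast hA.ne'
  have e : (Real.pi : ℂ) / (A : ℂ) * ((m : ℂ) - Complex.I * (A : ℂ) / 2) =
      (Real.pi : ℂ) * m / A - (Real.pi / 2) * Complex.I := by
    field_simp
  rw [e, Complex.sinh_sub, Complex.cosh_mul_I, Complex.sinh_mul_I, Complex.cos_pi_div_two,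
    Complex.sin_pi_div_two, mul_zero, zero_sub, one_mul, div_neg, mul_comm,
    ← div_div, div_self Complex.I_ne_zero]

end FiniteDensityNLS

end

theorem mainTheorem3 (A : ℝ) (hA : 0 < A) (c g : ℂ)
    (hc : FiniteDensityNLS.IsCoupling c) (hg : c = Complex.I * g) :
    FiniteDensityNLS.IsFiniteDensity (FiniteDensityNLS.solitonProfile A) ∧
    FiniteDensityNLS.HasScatteringData c (FiniteDensityNLS.solitonProfile A)
      (fun k => Complex.Gamma (1 / 2 - Complex.I * (FiniteDensityNLS.mu c k : ℂ) / (A : ℂ)) ^ 2 /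
        (Complex.Gamma (1 / 2 - g - Complex.I * (FiniteDensityNLS.mu c k : ℂ) / (A : ℂ)) *
          Complex.Gamma (1 / 2 + g - Complex.I * (FiniteDensityNLS.mu c k : ℂ) / (A : ℂ))))
      (fun k => -Complex.sin ((Real.pi : ℂ) * g) *
        (1 / Complex.cosh ((Real.pi : ℂ) * (FiniteDensityNLS.mu c k : ℂ) / (A : ℂ)))) ∧
    FiniteDensityNLS.HasScatteringData Complex.I (FiniteDensityNLS.solitonProfile A)
      (fun k => ((FiniteDensityNLS.mu Complex.I k : ℂ) - Complex.I * (A : ℂ) / 2) /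
        ((FiniteDensityNLS.mu Complex.I k : ℂ) + Complex.I * (A : ℂ) / 2))
      (fun _ => 0) ∧
    FiniteDensityNLS.QuenchMapsTo c Complex.I
      (fun k => ((FiniteDensityNLS.mu Complex.I k : ℂ) - Complex.I * (A : ℂ) / 2) /
        ((FiniteDensityNLS.mu Complex.I k : ℂ) + Complex.I * (A : ℂ) / 2))
      (fun _ => 0)
      (fun k =>
        Complex.Gamma (1 - Complex.I / (A : ℂ) *
          ((FiniteDensityNLS.mu c k : ℂ) - Complex.I * (A : ℂ) / 2)) ^ 2 /
        (Complex.Gamma (1 - g - Complex.I / (A : ℂ) *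
            ((FiniteDensityNLS.mu c k : ℂ) - Complex.I * (A : ℂ) / 2)) *
          Complex.Gamma (1 + g - Complex.I / (A : ℂ) *
            ((FiniteDensityNLS.mu c k : ℂ) - Complex.I * (A : ℂ) / 2))))
      (fun k => Complex.sin ((Real.pi : ℂ) * g) *
        (Complex.I / Complex.sinh ((Real.pi : ℂ) / (A : ℂ) *
          ((FiniteDensityNLS.mu c k : ℂ) - Complex.I * (A : ℂ) / 2)))) := by
  have hdata := FiniteDensityNLS.hasScatteringData_solitonProfile hc hg hA
  have hI := FiniteDensityNLS.hasScatteringData_I_solitonProfile hA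
  have hfd := FiniteDensityNLS.isFiniteDensity_solitonProfile hA
  refine ⟨hfd, hdata, hI, FiniteDensityNLS.solitonProfile A, hfd, hI, ?_⟩
  have hA' : (A : ℂ) ≠ 0 := by exact_mod_cast hA.ne'
  -- Passing to `μ - μ₁` adds `1/2` to each Gamma parameter; the cases `h = 0`, `g` and `-g` are the
  -- three arguments.
  have e : ∀ (h : ℂ) (m : ℝ), 1 + h - Complex.I / (A : ℂ) * ((m : ℂ) - Complex.I * (A : ℂ) / 2) =
      1 / 2 + h - Complex.I * (m : ℂ) / (A : ℂ) := by
    intro h m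
    field_simp
    linear_combination (A : ℂ) * Complex.I_sq
  have e0 := fun m : ℝ => e 0 m
  have e1 := fun m : ℝ => e (-g) m
  simp only [add_zero] at e0
  simp only [← sub_eq_add_neg] at e1
  simpa only [e, e0, e1, FiniteDensityNLS.sinh_shift A _ hA, mul_neg, neg_mul] using hdata
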